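/- **Language and system.** $\mathrm{AEON}_{core}$ programs run on a system of *context instances* $c$, arranged in an ownership network (a child relation), each with a dominator $\mathrm{lub}(c)$. A context instance carries a FIFO request queue $q$, an object store $\sigma$, a global environment $ge$, and a set $A$ of activations. An activation is either running, $(e,am,d,le,s)$, with event identifier $e$, access mode $am\in\{\mathsf{ro},\mathsf{ex}\}$, decorator $d\in\{\mathsf{synch},\mathsf{asynch},\mathsf{event}\}$, list of local call frames $le$ and command $s$, or is a pure lock $(e,am,\bot)$. A request is $(e,m,\vec v,d,am)$ or $(e,m,\vec v,\mathsf{lub}(\mathsf{event}\,c),am)$. Every method of a context instance has a fixed access mode and, for every list of arguments, a body. Commands are those of a sequential imperative language (skip, sequencing, assignment to local and global variables, object allocation, field update, conditional, loop, method call within the same context instance, $\mathsf{return}$), together with $y:=c.m(\vec x)$ and $\mathsf{asynch}\ c.m(\vec x)$, and the runtime commands $y:=\mathsf{suspend}[c]$ and $\mathsf{emit}$ (plus $y:=v$ and running local calls). Commands run by small steps; stores and global environments can be modified only in mode $\mathsf{ex}$; a remote call is possible only to a method whose access mode is that of the caller; a $\mathsf{return}$ leaves a context instance only when $le$ is a single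 frame. **Semantics.** A configuration is $(E,G)$, with $E$ the set of running events and $G$ the family of context instances. The steps $\to$ are as follows. * *Silent*: a running activation makes a local step. * *Synch/Asynch Call*: an activation of $c_0$ calling a method of a child $c_1\ne c_0$ of $c_0$ appends the request $(e,m,\vec v,\mathsf{synch}/\mathsf{asynch},am)$ to the queue of $c_1$; a synchronous caller is left at $\mathsf{suspend}[c_1]$, and an asynchronous caller continues. * *Synch Return*: when a $\mathsf{synch}$ activation of $e$ in $c_1$ returns $v$, the value is substituted for $\mathsf{suspend}[c_1]$ in an activation of $e$ in some $c_0\neq c_1$ awaiting it, and the returning activation becomes $(e,am,\bot)$. *Asynch Return*: a returning $\mathsf{asynch}$ activation becomes $(e,am,\bot)$. * *Event Call*: the environment calls a method $m$ of $c$, of access mode $am$, as an event $e\notin E$. Then $e$ is added to $E$, and $(e,m,\vec v,\mathsf{event},am)$ is appended to the queue of $c$ if $\mathrm{lub}(c)=c$, while otherwise $(e,m,\vec v,\mathsf{lub}(\mathsf{event}\,c),am)$ is appended to the queue of $\mathrm{lub}(c)$. * *Event Return & Commit*: if an $\mathsf{event}$ activation of $e$ returns $v$ and no request of $e$ is waiting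 in any queue, then $e$ is removed from $E$ and all activations of $e$ are removed from all context instances. * *Exclusive Access*: a request $(e,m,\vec v,d,\mathsf{ex})$ at the head of the queue of $c$ is dequeued if all activations in $c$ belong to $e$ and have mode $\mathsf{ex}$; $A$ becomes the singleton of a new activation running the body of $m$ on $\vec v$ with one empty frame. *ReadOnly Access*: a request of mode $\mathsf{ro}$ at the head is dequeued if $A$ has no activation of mode $\mathsf{ex}$, and such a new activation of mode $\mathsf{ro}$ is added to $A$. * *LUB Lock and Schedule*: a request $(e,m,\vec v,\mathsf{lub}(\mathsf{event}\,c),am)$ at the head of the queue of $c_0\ne c$ is dequeued if $A=\emptyset$ (for $am=\mathsf{ex}$), or if $A$ has no activation of mode $\mathsf{ex}$ (for $am=\mathsf{ro}$). Then $(e,am,\bot)$ is added to $A$, and $(e,m,\vec v,\mathsf{event},am)$ is appended to the queue of $c$. * *Call Promotion*: the first request of $e$ in the queue of a context instance moves to its front if its mode is $am$ and $(e,am,\bot)\in A$. The *linear semantics* $\twoheadrightarrow$ has the same steps, restricted to configurations in which at most one event has activations in $G$. A family $G$ is *quiescent* if all its queues and activation sets are empty. The *trace* of an execution is the list of its steps,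 each an event call, a commit with its result, or an internal step of some event; its *history* is the sublist of event calls and commits. An event identifier may be reused after its commit; the steps of an event are those made under its identifier after its call, up to and including its commit. **Corollary (Linearizability).** Let $G_I$ be quiescent. 1. For every finite execution $(\emptyset,G_I)\twoheadrightarrow^*(E,G)$ of the linear semantics: (a) *isolation*: between two steps of an event, other than its call, there are only event calls and steps of that same event; (b) *no reordering*: every step other than an event call is made on behalf of an event that has been called before and has not yet committed, and if an event $e$ commits before an event $e'$ is called, then all steps of $e$ other than its call precede all steps of $e'$. 2. Every finite execution $(\emptyset,G_I)\to^*(E,G)$ of $\mathrm{AEON}_{core}$ is linearizable, each event being linearized at its commit point. That is, let $H$ be its history. Every commit in $H$ is the commit of an event called earlier in $H$. Let $o_1,\dots,o_n$ be the committed events of $H$, listed in the order of their commits. This order respects real time: if $o_i$ commits before $o_j$ is called, then $i<j$. Moreover, there are a quiescent $G_1$ and * an execution $(\emptyset,G_I)\twoheadrightarrow^*(\emptyset,G_1)$ of the linear semantics whose history is sequential: the call of $o_1$, the commit of $o_1$, …, the call of $o_n$, the commit of $o_n$, with the same identifiers, targets, methods, arguments and results as in $H$; * an execution $(\emptyset,G_1)\to^*(E,G)$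 whose history consists precisely of the calls in $H$ of the events that have not committed, in their order in $H$. -/

import Mathlib

universe u

/-- The carrier sets of the language: event identifiers, context identifiers (one for each context
instance of the system), variables, field names, object locations, primitive values, method names
and source expressions. -/
structure AeonLang where
  EID : Type u
  CID : Type u
  Var : Type u
  Field : Type u
  Loc : Type u
  Prim : Type u
  Meth : Type u
  Expr : Type u

namespace Aeon

/-! ### Values, stores, commands -/

/-- Values; objects are values, given by reference. -/
inductive Val (L : AeonLang.{u}) : Type u
  | bool (b : Bool)
  | prim (p : L.Prim)
  | obj (o : L.Loc)

/-- An object: a partial map from fields to values. -/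
abbrev Obj (L : AeonLang.{u}) := L.Field → Option (Val L)

/-- The object store of a context instance. -/
abbrev Store (L : AeonLang.{u}) := L.Loc → Option (Obj L)

/-- Environments: partial maps from variables to values. A local environment is a list of these
(the call frames, the innermost one first); the global environment of a context is a single one. -/
abbrev Env (L : AeonLang.{u}) := L.Var → Option (Val L)

open Classical in
/-- Point update of a function. -/
noncomputable def upd {α β : Type*} (f : α → β) (a : α) (b : β) : α → β :=
  fun x => if x = a then b else f x

/-- Access modes: readonly and exclusive. -/
inductive Mode
  | ro
  | ex

/-- Commands. The last four are runtime commands. -/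
inductive Cmd (L : AeonLang.{u}) : Type u
  /-- `skip` -/
  | skip
  /-- `c₁ ; c₂` -/
  | seq (c₁ c₂ : Cmd L)
  /-- `x := e`, `x` local -/
  | assign (x : L.Var) (e : L.Expr)
  /-- `x := e`, `x` in the global environment of the context -/
  | gassign (x : L.Var) (e : L.Expr)
  /-- `x := new` -/
  | new (x : L.Var)
  /-- `x.f := e` -/
  | setField (x : L.Expr) (f : L.Field) (e : L.Expr)
  /-- `if e then c₁ else c₂` -/
  | ite (e : L.Expr) (c₁ c₂ : Cmd L)
  /-- `while e do c` -/
  | loop (e : L.Expr) (c : Cmd L)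
  /-- `y := m(args)`, a call inside the same context instance -/
  | localCall (y : L.Var) (m : L.Meth) (args : List L.Expr)
  /-- `return e` -/
  | ret (e : L.Expr)
  /-- `y := c.m(args)`, a synchronous call to the context instance `c` -/
  | call (y : L.Var) (c : L.CID) (m : L.Meth) (args : List L.Expr)
  /-- `asynch c.m(args)` -/
  | async (c : L.CID) (m : L.Meth) (args : List L.Expr)
  /-- `y := { c }`, a local call in progress -/
  | frame (y : L.Var) (c : Cmd L)
  /-- `y := v` -/
  | assignVal (y : L.Var) (v : Val L)
  /-- `y := suspend[c]`, waiting for the result of a synchronous call to `c` -/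
  | suspend (y : L.Var) (c : L.CID)
  /-- `emit`, the placeholder left by an asynchronous call -/
  | emit

open Classical in
/-- `s[suspend[c] ← v]` -/
noncomputable def Cmd.fill {L : AeonLang.{u}} (c : L.CID) (v : Val L) : Cmd L → Cmd L
  | .suspend y c' => if c' = c then .assignVal y v else .suspend y c'
  | .seq s₁ s₂ => .seq (s₁.fill c v) (s₂.fill c v)
  | .ite e s₁ s₂ => .ite e (s₁.fill c v) (s₂.fill c v)
  | .loop e s => .loop e (s.fill c v)
  | .frame y s => .frame y (s.fill c v)
  | s => s

/-- `suspend[c]` occurs in the command. -/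
def Cmd.Awaits {L : AeonLang.{u}} (c : L.CID) : Cmd L → Prop
  | .suspend _ c' => c' = c
  | .seq s₁ s₂ => s₁.Awaits c ∨ s₂.Awaits c
  | .ite _ s₁ s₂ => s₁.Awaits c ∨ s₂.Awaits c
  | .loop _ s => s.Awaits c
  | .frame _ s => s.Awaits c
  | _ => False

/-- `s[emit ← skip]` -/
def Cmd.dropEmit {L : AeonLang.{u}} : Cmd L → Cmd L
  | .emit => .skip
  | .seq s₁ s₂ => .seq s₁.dropEmit s₂.dropEmit
  | .ite e s₁ s₂ => .ite e s₁.dropEmit s₂.dropEmit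
  | .loop e s => .loop e s.dropEmit
  | .frame y s => .frame y s.dropEmit
  | s => s

/-- A program: the static data of a system. Nothing is assumed about any of the components. -/
structure Program (L : AeonLang.{u}) where
  /-- `child c c'`: in the ownership network, `c'` is a child of `c`. -/
  child : L.CID → L.CID → Prop
  /-- The dominator `lub(G, c)`, i.e. the context instance at which the events that target `c`
  are sequenced. -/
  lub : L.CID → L.CID
  /-- The access mode of a method in a context instance. -/
  mode : L.CID → L.Meth → Mode
  /-- The method environment: `body c m vs` is the code `me(m)(vs)` in the context instance `c`. -/
  body : L.CID → L.Meth → List (Val L) → Cmd L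
  /-- The (partial) evaluation function of expressions, `⟦e⟧(σ, ge, le)`. -/
  eval : L.Expr → Store L → Env L → List (Env L) → Option (Val L)

/-! ### Intra-context semantics -/

/-- Labels of the intra-context semantics. Event calls are issued by the environment in the rules
of the inter-context semantics, so no rule emits an `event` label. -/
inductive Label (L : AeonLang.{u}) : Type u
  | tau
  | ret (v : Val L)
  | synch (c : L.CID) (m : L.Meth) (vs : List (Val L)) (am : Mode)
  | asynch (c : L.CID) (m : L.Meth) (vs : List (Val L)) (am : Mode)
  | event (c : L.CID) (m : L.Meth) (vs : List (Val L))

/-- Configurations `(σ, ge, le, s)`; the access mode, which never changes, is a parameter of the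
transition relation. -/
structure Local (L : AeonLang.{u}) where
  st : Store L
  ge : Env L
  le : List (Env L)
  s : Cmd L

/-- Evaluation of a list of expressions. -/
def Program.evals {L : AeonLang.{u}} (P : Program L) (es : List L.Expr) (st : Store L)
    (ge : Env L) (le : List (Env L)) (vs : List (Val L)) : Prop :=
  List.Forall₂ (fun e v => P.eval e st ge le = some v) es vs

/-- The intra-context semantics of the context instance `self` in access mode `am`. Only an
exclusive activation can change the store or the global environment. -/
inductive Intra {L : AeonLang.{u}} (P : Program L) (self : L.CID) :
    Mode → Local L → Label L → Local L → Prop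
  | seqSkip {am st ge le c} :
      Intra P self am ⟨st, ge, le, .seq .skip c⟩ .tau ⟨st, ge, le, c⟩
  | sequence {am st ge le c₁ c₂ st' ge' le'} :
      Intra P self am ⟨st, ge, le, c₁⟩ .tau ⟨st', ge', le', .skip⟩ →
      Intra P self am ⟨st, ge, le, .seq c₁ c₂⟩ .tau ⟨st', ge', le', c₂⟩
  | sequenceLabel {am st ge le c₁ c₂ ℓ st' ge' le' c₁'} :
      Intra P self am ⟨st, ge, le, c₁⟩ ℓ ⟨st', ge', le', c₁'⟩ →
      Intra P self am ⟨st, ge, le, .seq c₁ c₂⟩ ℓ ⟨st', ge', le', .seq c₁' c₂⟩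
  | assign {am st ge f le x e v} :
      P.eval e st ge (f :: le) = some v →
      Intra P self am ⟨st, ge, f :: le, .assign x e⟩ .tau ⟨st, ge, upd f x (some v) :: le, .skip⟩
  | assignVal {am st ge f le x v} :
      Intra P self am ⟨st, ge, f :: le, .assignVal x v⟩ .tau
        ⟨st, ge, upd f x (some v) :: le, .skip⟩
  | gassign {st ge le x e v} :
      P.eval e st ge le = some v →
      Intra P self .ex ⟨st, ge, le, .gassign x e⟩ .tau ⟨st, upd ge x (some v), le, .skip⟩
  | new {st ge f le x o} :
      st o = none →
      Intra P self .ex ⟨st, ge, f :: le, .new x⟩ .tau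
        ⟨upd st o (some fun _ => none), ge, upd f x (some (.obj o)) :: le, .skip⟩
  | fieldUpdate {st ge le x f e o r v} :
      P.eval x st ge le = some (.obj o) → st o = some r → P.eval e st ge le = some v →
      Intra P self .ex ⟨st, ge, le, .setField x f e⟩ .tau
        ⟨upd st o (some (upd r f (some v))), ge, le, .skip⟩
  | iteTrue {am st ge le e c₁ c₂} :
      P.eval e st ge le = some (.bool true) →
      Intra P self am ⟨st, ge, le, .ite e c₁ c₂⟩ .tau ⟨st, ge, le, c₁⟩
  | iteFalse {am st ge le e c₁ c₂} :
      P.eval e st ge le = some (.bool false) →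
      Intra P self am ⟨st, ge, le, .ite e c₁ c₂⟩ .tau ⟨st, ge, le, c₂⟩
  | loop {am st ge le e c} :
      Intra P self am ⟨st, ge, le, .loop e c⟩ .tau
        ⟨st, ge, le, .ite e (.seq c (.loop e c)) .skip⟩
  | localCall {am st ge le y m es vs} :
      P.evals es st ge le vs →
      Intra P self am ⟨st, ge, le, .localCall y m es⟩ .tau
        ⟨st, ge, (fun _ => none) :: le, .frame y (P.body self m vs)⟩
  | frame {am st ge le y c ℓ st' ge' le' c'} :
      Intra P self am ⟨st, ge, le, c⟩ ℓ ⟨st', ge', le', c'⟩ →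
      Intra P self am ⟨st, ge, le, .frame y c⟩ ℓ ⟨st', ge', le', .frame y c'⟩
  | retSeq {am st ge le e c} :
      Intra P self am ⟨st, ge, le, .seq (.ret e) c⟩ .tau ⟨st, ge, le, .ret e⟩
  | localReturn {am st ge f g le y e v} :
      P.eval e st ge (f :: g :: le) = some v →
      Intra P self am ⟨st, ge, f :: g :: le, .frame y (.ret e)⟩ .tau
        ⟨st, ge, upd g y (some v) :: le, .skip⟩
  | contextReturn {am st ge le e v} :
      le.length = 1 → P.eval e st ge le = some v →
      Intra P self am ⟨st, ge, le, .ret e⟩ (.ret v) ⟨st, ge, [], .skip⟩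
  | contextReturnSeq {am st ge le e c v} :
      le.length = 1 → P.eval e st ge le = some v →
      Intra P self am ⟨st, ge, le, .seq (.ret e) c⟩ (.ret v) ⟨st, ge, [], .skip⟩
  | synchCall {am st ge le y c m es vs} :
      P.evals es st ge le vs → P.mode c m = am →
      Intra P self am ⟨st, ge, le, .call y c m es⟩ (.synch c m vs am) ⟨st, ge, le, .suspend y c⟩
  | asynchCall {am st ge le c m es vs} :
      P.evals es st ge le vs → P.mode c m = am →
      Intra P self am ⟨st, ge, le, .async c m es⟩ (.asynch c m vs am) ⟨st, ge, le, .emit⟩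

/-! ### Inter-context semantics -/

/-- Decorators. -/
inductive Dec
  | synch
  | asynch
  | event

/-- Activations: running ones, and `(eid, am, ⊥)`, which only serves as a lock. -/
inductive Atv (L : AeonLang.{u}) : Type u
  | run (e : L.EID) (am : Mode) (d : Dec) (le : List (Env L)) (s : Cmd L)
  | bot (e : L.EID) (am : Mode)

/-- The event of an activation. -/
def Atv.eid {L : AeonLang.{u}} : Atv L → L.EID
  | .run e _ _ _ _ => e
  | .bot e _ => e

/-- The access mode of an activation. -/
def Atv.mode {L : AeonLang.{u}} : Atv L → Mode
  | .run _ am _ _ _ => am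
  | .bot _ am => am

/-- Requests: `(eid, m, vs, d, am)`, and `(eid, m, vs, lub (event c), am)`, by which an event that
targets `c` asks to lock the dominator of `c`. -/
inductive Req (L : AeonLang.{u}) : Type u
  | call (e : L.EID) (m : L.Meth) (vs : List (Val L)) (d : Dec) (am : Mode)
  | lub (e : L.EID) (m : L.Meth) (vs : List (Val L)) (c : L.CID) (am : Mode)

/-- The event of a request. -/
def Req.eid {L : AeonLang.{u}} : Req L → L.EID
  | .call e _ _ _ _ => e
  | .lub e _ _ _ _ => e

/-- The access mode of a request. -/
def Req.mode {L : AeonLang.{u}} : Req L → Mode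
  | .call _ _ _ _ am => am
  | .lub _ _ _ _ am => am

/-- A context instance: request queue, store, global environment and activation set. -/
structure Ctx (L : AeonLang.{u}) where
  q : List (Req L)
  st : Store L
  ge : Env L
  A : Set (Atv L)

/-- The context instances of the system, indexed by their identifiers. -/
abbrev Network (L : AeonLang.{u}) := L.CID → Ctx L

/-- Configurations `(E, G)`. -/
abbrev Config (L : AeonLang.{u}) := Set L.EID × Network L

/-- `K[q ← K.q · r]` -/
def Ctx.push {L : AeonLang.{u}} (K : Ctx L) (r : Req L) : Ctx L :=
  { K with q := K.q ++ [r] }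

/-- `K[σ ← st][ge ← ge][A ← (A \ {a}) ∪ {a'}]` -/
def Ctx.advance {L : AeonLang.{u}} (K : Ctx L) (st : Store L) (ge : Env L) (a a' : Atv L) : Ctx L :=
  { K with st := st, ge := ge, A := insert a' (K.A \ {a}) }

/-- `G ↓ e`: remove all the activations of the event `e`. -/
def release {L : AeonLang.{u}} (e : L.EID) (G : Network L) : Network L :=
  fun c => { G c with A := {a ∈ (G c).A | a.eid ≠ e} }

/-- What a step does: a step inside the event `e`; the call of the method `m` of the context
instance `c` with arguments `vs` as a new event `e`; the return and commit of the event `e` with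
result `v`. -/
inductive Action (L : AeonLang.{u}) : Type u
  | internal (e : L.EID)
  | call (e : L.EID) (c : L.CID) (m : L.Meth) (vs : List (Val L))
  | commit (e : L.EID) (v : Val L)

/-- The inter-context semantics. The lifting of intra-context transitions to a context instance is
written out in the rules that use it. -/
inductive Step {L : AeonLang.{u}} (P : Program L) : Config L → Action L → Config L → Prop
  /-- A silent step of an activation. -/
  | silent {E G c e am d le s st' ge' le' s'} :
      Atv.run e am d le s ∈ (G c).A →
      Intra P c am ⟨(G c).st, (G c).ge, le, s⟩ .tau ⟨st', ge', le', s'⟩ →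
      Step P (E, G) (.internal e)
        (E, upd G c ((G c).advance st' ge' (.run e am d le s) (.run e am d le' s')))
  | synchCall {E G c₀ c₁ e am d le s m vs st' ge' le' s'} :
      P.child c₀ c₁ → c₀ ≠ c₁ →
      Atv.run e am d le s ∈ (G c₀).A →
      Intra P c₀ am ⟨(G c₀).st, (G c₀).ge, le, s⟩ (.synch c₁ m vs am) ⟨st', ge', le', s'⟩ →
      Step P (E, G) (.internal e)
        (E, upd (upd G c₀
            ((G c₀).advance st' ge' (.run e am d le s) (.run e am d le' s')))
          c₁ ((G c₁).push (.call e m vs .synch am)))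
  | asynchCall {E G c₀ c₁ e am d le s m vs st' ge' le' s'} :
      P.child c₀ c₁ → c₀ ≠ c₁ →
      Atv.run e am d le s ∈ (G c₀).A →
      Intra P c₀ am ⟨(G c₀).st, (G c₀).ge, le, s⟩ (.asynch c₁ m vs am) ⟨st', ge', le', s'⟩ →
      Step P (E, G) (.internal e)
        (E, upd (upd G c₀
            ((G c₀).advance st' ge' (.run e am d le s) (.run e am d le' s'.dropEmit)))
          c₁ ((G c₁).push (.call e m vs .asynch am)))
  | synchReturn {E G c₀ c₁ e am le s v st' ge' le' s' am₀ d₀ le₀ s₀} :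
      c₀ ≠ c₁ →
      Atv.run e am .synch le s ∈ (G c₁).A →
      Intra P c₁ am ⟨(G c₁).st, (G c₁).ge, le, s⟩ (.ret v) ⟨st', ge', le', s'⟩ →
      Atv.run e am₀ d₀ le₀ s₀ ∈ (G c₀).A → s₀.Awaits c₁ →
      Step P (E, G) (.internal e)
        (E, upd (upd G c₀
            ((G c₀).advance (G c₀).st (G c₀).ge
              (.run e am₀ d₀ le₀ s₀) (.run e am₀ d₀ le₀ (s₀.fill c₁ v))))
          c₁ ((G c₁).advance st' ge' (.run e am .synch le s) (.bot e am)))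
  | asynchReturn {E G c e am le s v st' ge' le' s'} :
      Atv.run e am .asynch le s ∈ (G c).A →
      Intra P c am ⟨(G c).st, (G c).ge, le, s⟩ (.ret v) ⟨st', ge', le', s'⟩ →
      Step P (E, G) (.internal e)
        (E, upd G c ((G c).advance st' ge' (.run e am .asynch le s) (.bot e am)))
  | eventCallUnshared {E G c e m vs} :
      e ∉ E → P.lub c = c →
      Step P (E, G) (.call e c m vs)
        (insert e E, upd G c ((G c).push (.call e m vs .event (P.mode c m))))
  | eventCallShared {E G c e m vs} :
      e ∉ E → P.lub c ≠ c →
      Step P (E, G) (.call e c m vs)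
        (insert e E, upd G (P.lub c) ((G (P.lub c)).push (.lub e m vs c (P.mode c m))))
  /-- An event commits when its initial activation returns, once no call made by the event is
  still waiting in a queue; all its locks are then released. -/
  | eventReturnCommit {E G c e am le s v st' ge' le' s'} :
      Atv.run e am .event le s ∈ (G c).A →
      Intra P c am ⟨(G c).st, (G c).ge, le, s⟩ (.ret v) ⟨st', ge', le', s'⟩ →
      (∀ c', ∀ r ∈ (G c').q, r.eid ≠ e) →
      Step P (E, G) (.commit e v)
        (E \ {e}, release e (upd G c
          ((G c).advance st' ge' (.run e am .event le s) (.run e am .event le' s'))))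
  | exclusiveAccess {E G c e m vs d q'} :
      (G c).q = .call e m vs d .ex :: q' →
      (∀ a ∈ (G c).A, a.eid = e ∧ a.mode = .ex) →
      Step P (E, G) (.internal e)
        (E, upd G c { G c with
          q := q', A := {.run e .ex d [fun _ => none] (P.body c m vs)} })
  | readOnlyAccess {E G c e m vs d q'} :
      (G c).q = .call e m vs d .ro :: q' →
      (∀ a ∈ (G c).A, a.mode ≠ .ex) →
      Step P (E, G) (.internal e)
        (E, upd G c { G c with
          q := q', A := insert (.run e .ro d [fun _ => none] (P.body c m vs)) (G c).A })
  | lubExclusive {E G c₀ c e m vs q'} :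
      c₀ ≠ c →
      (G c₀).q = .lub e m vs c .ex :: q' →
      (G c₀).A = ∅ →
      Step P (E, G) (.internal e)
        (E, upd (upd G c₀ { G c₀ with q := q', A := {.bot e .ex} })
          c ((G c).push (.call e m vs .event .ex)))
  | lubReadOnly {E G c₀ c e m vs q'} :
      c₀ ≠ c →
      (G c₀).q = .lub e m vs c .ro :: q' →
      (∀ a ∈ (G c₀).A, a.mode ≠ .ex) →
      Step P (E, G) (.internal e)
        (E, upd (upd G c₀ { G c₀ with q := q', A := insert (.bot e .ro) (G c₀).A })
          c ((G c).push (.call e m vs .event .ro)))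
  | callPromotion {E G c q₀ r q₁} :
      (G c).q = q₀ ++ r :: q₁ →
      (∀ r' ∈ q₀, r'.eid ≠ r.eid) →
      Atv.bot r.eid r.mode ∈ (G c).A →
      Step P (E, G) (.internal r.eid) (E, upd G c { G c with q := r :: (q₀ ++ q₁) })

/-- The set of events that are activated in some context instance. -/
def Act {L : AeonLang.{u}} (G : Network L) : Set L.EID :=
  {e | ∃ c, ∃ a ∈ (G c).A, a.eid = e}

/-- The linear semantics: at most one event is activated in the system. -/
def LinStep {L : AeonLang.{u}} (P : Program L) (X : Config L) (α : Action L) (Y : Config L) :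
    Prop :=
  (Act X.2).Subsingleton ∧ Step P X α Y ∧ (Act Y.2).Subsingleton

/-- Finite executions of a labelled transition relation, with the list of their actions. -/
inductive Run {S A : Type*} (R : S → A → S → Prop) : S → List A → S → Prop
  | nil {x} : Run R x [] x
  | cons {x a y T z} : R x a y → Run R y T z → Run R x (a :: T) z

/-- Executions of the normal semantics. -/
abbrev Exec {L : AeonLang.{u}} (P : Program L) := Run (Step P)

/-- Executions of the linear semantics. -/
abbrev LinExec {L : AeonLang.{u}} (P : Program L) := Run (LinStep P)

/-- No request is queued and nothing is activated; stores and global environments are arbitrary.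
Initial configurations are those with no running event and a quiescent network. -/
def Quiescent {L : AeonLang.{u}} (G : Network L) : Prop :=
  ∀ c, (G c).q = [] ∧ (G c).A = ∅

/-! ### Traces and histories -/

/-- The event of an action. -/
def Action.eid {L : AeonLang.{u}} : Action L → L.EID
  | .internal e => e
  | .call e _ _ _ => e
  | .commit e _ => e

/-- The action is an event call. -/
def Action.IsCall {L : AeonLang.{u}} (α : Action L) : Prop := ∃ e c m vs, α = .call e c m vs

/-- The action is the commit of an event. -/
def Action.IsCommit {L : AeonLang.{u}} (α : Action L) : Prop := ∃ e v, α = .commit e v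

open Classical in
/-- The history of a trace: its event calls and commits, in order. -/
noncomputable def history {L : AeonLang.{u}} (T : List (Action L)) : List (Action L) :=
  T.filter fun α => decide (α.IsCall ∨ α.IsCommit)

/-- Position `k` of `T` belongs to the event that was called at position `i`: it is an internal
step or the commit of that event, and the event identifier was not called or committed in
between. -/
def Belongs {L : AeonLang.{u}} (T : List (Action L)) (i k : ℕ) : Prop :=
  i < k ∧ ∃ α β, T[i]? = some α ∧ T[k]? = some β ∧ α.IsCall ∧ ¬ β.IsCall ∧ α.eid = β.eid ∧
    ∀ j γ, i < j → j < k → T[j]? = some γ → γ.eid = α.eid → ¬ γ.IsCall ∧ ¬ γ.IsCommit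

/-- Isolation: from an internal step of an event to a later step of this event that is not
preceded by its commit, only this event makes progress (calls may arrive). -/
def Isolated {L : AeonLang.{u}} (T : List (Action L)) : Prop :=
  ∀ (i j k : ℕ) (e : L.EID) (α β : Action L), i < j → j < k →
    T[i]? = some (.internal e) → T[j]? = some β → T[k]? = some α → α.eid = e → ¬ α.IsCall →
    (∀ (l : ℕ) (γ : Action L), i < l → l < k → T[l]? = some γ → γ.eid = e → ¬ γ.IsCommit) →
    β.IsCall ∨ β.eid = e

/-- Non-overlapping events are not reordered: every step is made on behalf of an event that has
been called and has not yet committed, and if an event commits before another one is called, then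
all the steps of the former precede all the steps of the latter. -/
def KeepsOrder {L : AeonLang.{u}} (T : List (Action L)) : Prop :=
  (∀ k α, T[k]? = some α → ¬ α.IsCall → ∃ i, Belongs T i k) ∧
  ∀ i j i' α, Belongs T i j → T[j]? = some α → α.IsCommit → j < i' →
    ∀ k k', Belongs T i k → Belongs T i' k' → k < k'

/-- A completed event of a history: the positions of its call and of its commit, its identifier,
target, method, arguments and result. -/
structure Completed (L : AeonLang.{u}) where
  inv : ℕ
  res : ℕ
  e : L.EID
  c : L.CID
  m : L.Meth
  vs : List (Val L)
  v : Val L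

/-- `o` is a completed event of the history `H`. -/
def Completed.In {L : AeonLang.{u}} (o : Completed L) (H : List (Action L)) : Prop :=
  Belongs H o.inv o.res ∧ H[o.inv]? = some (.call o.e o.c o.m o.vs) ∧
    H[o.res]? = some (.commit o.e o.v)

/-- The sequential history in which the given events are called and commit one after the other. -/
def sequential {L : AeonLang.{u}} (ops : List (Completed L)) : List (Action L) :=
  ops.flatMap fun o => [.call o.e o.c o.m o.vs, .commit o.e o.v]

/-- `ops` lists precisely the completed events of `H`, each one linearized at its commit point, and
it respects the real-time order: no event is listed after an event that was called only after its
commit. -/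
def LinearizedAtCommit {L : AeonLang.{u}} (H : List (Action L)) (ops : List (Completed L)) : Prop :=
  (∀ o ∈ ops, o.In H) ∧
  (∀ j α, H[j]? = some α → α.IsCommit → ∃ o ∈ ops, o.res = j) ∧
  ops.Pairwise (fun o o' => o.res < o'.res) ∧
  ops.Pairwise (fun o o' => ¬ o'.res < o.inv)

open Classical in
/-- The calls of a history whose events have not committed, in order. -/
noncomputable def pendingCalls {L : AeonLang.{u}} : List (Action L) → List (Action L)
  | [] => []
  | α :: H =>
    if α.IsCall ∧ ∀ β ∈ H, β.IsCommit → β.eid ≠ α.eid then α :: pendingCalls H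
    else pendingCalls H

end Aeon

open Aeon

/-!
The semantics obeys strict two-phase locking. Once an event has an activation of some mode in a
context instance, it has one of that mode there until its commit, be it only a pure lock
`(e, am, ⊥)` (`Evolves.persists`); an exclusive activation excludes all other events (`Exclusion`); and
only exclusive activations write (`Intra.eq_of_ro`). The ownership network and the choice of the
dominators play no role.

*Linearizability.* Consider an execution without commits that starts in a quiescent network,
followed by the commit of an event `e`. Let `W` be the set of context instances on which `e` holds
an exclusive lock when it commits. Since locks are never given up before, no other event has ever
been activated in `W`, and outside of `W` the event `e` has read only stores that nobody has
modified. Hence the execution splits (`Exec.extract`): the steps of `e`, the commit included, can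
be made alone from the initial network, and they modify only `W`; the steps of the other events
can then be made from the resulting network, without any request or activation of `e` in sight.
Both halves are instances of one notion, the restriction of a network to the events that satisfy a
predicate, in which the stores of some context instances are frozen: a step of an event that is
kept remains a step (`Step.restrict`), and a step of any other event becomes invisible
(`Step.restrict_eq`). Requests are filtered instead of being permuted, so that the order of the
queues needs no attention: removing requests of other events keeps the head of a queue at its
head, and a call promotion past them becomes a trivial one. Applying the splitting at each commit,
from left to right, collects the committed events in a sequential execution and leaves the pending
ones behind (`Exec.linearizable`).

*The linear semantics.* After an internal step of an event, this event stays activated until it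
commits (`Exec.mem_act_of_internal`), and any other event that made an internal step or committed
meanwhile would be activated at the same time; this gives isolation. Every step other than a call
is made by a running event (`Tracked`), and a running event has a last call that no commit follows
(`Exec.exists_pendingAt`); this gives the preservation of the order of events.
-/

namespace Aeon

variable {L : AeonLang.{u}} {P : Program L}

/-! ### Executions -/

theorem Run.append {S A : Type*} {R : S → A → S → Prop} {x y z : S} {T T' : List A}
    (h : Run R x T y) (h' : Run R y T' z) : Run R x (T ++ T') z := by
  induction h with
  | nil => exact h'
  | cons hs _ ih => exact .cons hs (ih h')

theorem Run.snoc {S A : Type*} {R : S → A → S → Prop} {x y z : S} {T : List A} {a : A}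
    (h : Run R x T y) (h' : R y a z) : Run R x (T ++ [a]) z :=
  h.append (.cons h' .nil)

theorem Run.mono {S A : Type*} {R R' : S → A → S → Prop} (hR : ∀ x a y, R x a y → R' x a y)
    {x y : S} {T : List A} (h : Run R x T y) : Run R' x T y := by
  induction h with
  | nil => exact .nil
  | cons hs _ ih => exact .cons (hR _ _ _ hs) ih

/-- Induction along a run from a fixed initial state, one step being added at the end. -/
theorem Run.snoc_induction {S A : Type*} {R : S → A → S → Prop} {x : S}
    {motive : ∀ T y, Run R x T y → Prop} (nil : motive [] x .nil)
    (snoc : ∀ T y a z (h : Run R x T y) (hs : R y a z), motive T y h →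
      motive (T ++ [a]) z (h.snoc hs))
    {T : List A} {y : S} (h : Run R x T y) : motive T y h := by
  suffices H : ∀ {w : S} {T' : List A} {y : S}, Run R w T' y →
      ∀ T (h : Run R x T w), motive T w h → ∃ h', motive (T ++ T') y h' from
    (H h [] .nil nil).2
  intro w T' y h
  induction h with
  | nil => intro T h hm; simpa using ⟨h, hm⟩
  | cons hs _ ih =>
    intro T hT hm
    simpa using ih _ (hT.snoc hs) (snoc _ _ _ _ hT hs hm)

theorem Run.split_at {S A : Type*} {R : S → A → S → Prop} {x y : S} {T : List A}
    (h : Run R x T y) {i : ℕ} {a : A} (hi : T[i]? = some a) :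
    ∃ z z', Run R x (T.take i) z ∧ R z a z' ∧ Run R z' (T.drop (i + 1)) y := by
  induction h generalizing i with
  | nil => simp at hi
  | cons hs hr ih =>
    cases i with
    | zero =>
      simp only [List.getElem?_cons_zero, Option.some.injEq] at hi
      subst hi
      exact ⟨_, _, by simpa using Run.nil, hs, by simpa using hr⟩
    | succ i =>
      obtain ⟨z, z', h₁, h₂, h₃⟩ := ih (by simpa using hi)
      exact ⟨z, z', by simpa using Run.cons hs h₁, h₂, by simpa using h₃⟩

/-! ### Point updates -/

@[simp]
theorem upd_self {α β : Type*} (f : α → β) (a : α) (b : β) : upd f a b a = b := by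
  simp [upd]

theorem upd_of_ne {α β : Type*} (f : α → β) {a x : α} (b : β) (h : x ≠ a) : upd f a b x = f x := by
  simp [upd, h]

/-! ### Which part of the state a step reads and writes -/

/-- Readonly activations leave the store and the global environment alone. -/
theorem Intra.eq_of_ro {c : L.CID} {am : Mode} {X Y : Local L} {ℓ : Label L}
    (h : Intra P c am X ℓ Y) (ham : am = .ro) : Y.st = X.st ∧ Y.ge = X.ge := by
  induction h <;> first | exact ⟨rfl, rfl⟩ | (simp at ham) | (rename_i ih; exact ih ham)

/-- Returning from a context instance leaves the store and the global environment alone. -/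
theorem Intra.eq_of_ret {c : L.CID} {am : Mode} {X Y : Local L} {ℓ : Label L} {v : Val L}
    (h : Intra P c am X ℓ Y) (hℓ : ℓ = .ret v) : Y.st = X.st ∧ Y.ge = X.ge := by
  induction h <;> first | exact ⟨rfl, rfl⟩ | (simp at hℓ) | (rename_i ih; exact ih hℓ)

/-- What a step can do to the activations, the store and the global environment of a single
context instance: nothing; the progress of an activation, which writes only in exclusive mode; the
acquisition of the instance in exclusive or in readonly mode; the release of the locks of an event
that commits. -/
inductive LockStep : Action L → Ctx L → Ctx L → Prop
  | same {α K K'} : K'.A = K.A → K'.st = K.st → K'.ge = K.ge → LockStep α K K'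
  | advance {α K K' a a'} : a ∈ K.A → a.eid = α.eid → a'.eid = a.eid → a'.mode = a.mode →
      (a.mode = .ro → K'.st = K.st ∧ K'.ge = K.ge) → K'.A = insert a' (K.A \ {a}) →
      LockStep α K K'
  | exclusive {α K K' a'} : (∀ a ∈ K.A, a.eid = α.eid ∧ a.mode = .ex) → a'.eid = α.eid →
      a'.mode = .ex → K'.st = K.st → K'.ge = K.ge → K'.A = {a'} → LockStep α K K'
  | readOnly {α K K' a'} : (∀ a ∈ K.A, a.mode ≠ .ex) → a'.eid = α.eid → a'.mode = .ro →
      K'.st = K.st → K'.ge = K.ge → K'.A = insert a' K.A → LockStep α K K'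
  | release {α K K'} : α.IsCommit → K'.st = K.st → K'.ge = K.ge →
      K'.A = {a ∈ K.A | a.eid ≠ α.eid} → LockStep α K K'

open Classical in
/-- The requests of the events that satisfy `p`, in their order. -/
noncomputable def reqs (p : L.EID → Prop) (q : List (Req L)) : List (Req L) :=
  q.filter fun r => decide (p r.eid)

theorem mem_reqs {p : L.EID → Prop} {q : List (Req L)} {r : Req L} :
    r ∈ reqs p q ↔ r ∈ q ∧ p r.eid := by
  simp [reqs]

theorem reqs_cons_pos {p : L.EID → Prop} {r : Req L} (q : List (Req L)) (h : p r.eid) :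
    reqs p (r :: q) = r :: reqs p q := by
  simp [reqs, h]

theorem reqs_cons_neg {p : L.EID → Prop} {r : Req L} (q : List (Req L)) (h : ¬ p r.eid) :
    reqs p (r :: q) = reqs p q := by
  simp [reqs, h]

theorem reqs_append (p : L.EID → Prop) (q q' : List (Req L)) :
    reqs p (q ++ q') = reqs p q ++ reqs p q' := by
  simp [reqs]

/-- What a step can do to a single context instance. In particular it keeps the requests of the
other events, in their order. -/
def Evolves (α : Action L) (K K' : Ctx L) : Prop :=
  LockStep α K K' ∧ ∀ p : L.EID → Prop, ¬ p α.eid → reqs p K'.q = reqs p K.q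

theorem Evolves.refl (α : Action L) (K : Ctx L) : Evolves α K K :=
  ⟨.same rfl rfl rfl, fun _ _ => rfl⟩

theorem Evolves.push {α : Action L} {r : Req L} (h : r.eid = α.eid) (K : Ctx L) :
    Evolves α K (K.push r) :=
  ⟨.same rfl rfl rfl, fun p hp => by
    rw [← h] at hp
    simp [Ctx.push, reqs, hp]⟩

theorem Evolves.advance {α : Action L} {K : Ctx L} {st : Store L} {ge : Env L} {a a' : Atv L}
    (ha : a ∈ K.A) (he : a.eid = α.eid) (he' : a'.eid = a.eid) (hm : a'.mode = a.mode)
    (hro : a.mode = .ro → st = K.st ∧ ge = K.ge) : Evolves α K (K.advance st ge a a') :=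
  ⟨.advance ha he he' hm hro rfl, fun _ _ => rfl⟩

theorem Evolves.upd {α : Action L} {G : Network L} {c : L.CID} {K : Ctx L}
    (h : Evolves α (G c) K) (c' : L.CID) : Evolves α (G c') (upd G c K c') := by
  by_cases hc : c' = c
  · subst hc; simpa using h
  · rw [upd_of_ne _ _ hc]; exact .refl _ _

theorem Evolves.upd₂ {α : Action L} {G : Network L} {c₀ c₁ : L.CID} {K₀ K₁ : Ctx L}
    (h₀ : Evolves α (G c₀) K₀) (h₁ : Evolves α (G c₁) K₁) (c' : L.CID) :
    Evolves α (G c') (Aeon.upd (Aeon.upd G c₀ K₀) c₁ K₁ c') := by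
  by_cases hc : c' = c₁
  · subst hc; simpa using h₁
  · rw [upd_of_ne _ _ hc]; exact h₀.upd c'

theorem Step.evolves {E E' : Set L.EID} {G G' : Network L} {α : Action L}
    (h : Step P (E, G) α (E', G')) (c : L.CID) : Evolves α (G c) (G' c) := by
  cases h with
  | silent ha hi =>
    refine .upd ?_ c
    exact .advance ha rfl rfl rfl fun h => hi.eq_of_ro h
  | synchCall _ _ ha hi =>
    refine .upd₂ ?_ ?_ c
    · exact .advance ha rfl rfl rfl fun h => hi.eq_of_ro h
    · exact .push rfl _
  | asynchCall _ _ ha hi =>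
    refine .upd₂ ?_ ?_ c
    · exact .advance ha rfl rfl rfl fun h => hi.eq_of_ro h
    · exact .push rfl _
  | synchReturn _ ha hi ha' _ =>
    refine .upd₂ ?_ ?_ c
    · exact .advance ha' rfl rfl rfl fun _ => ⟨rfl, rfl⟩
    · exact .advance ha rfl rfl rfl fun h => hi.eq_of_ro h
  | asynchReturn ha hi =>
    refine .upd ?_ c
    exact .advance ha rfl rfl rfl fun h => hi.eq_of_ro h
  | eventCallUnshared =>
    refine .upd ?_ c
    exact .push rfl _
  | eventCallShared =>
    refine .upd ?_ c
    exact .push rfl _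
  | @eventReturnCommit _ G c₁ e _ _ _ v st' ge' le' s' _ hi _ =>
    have h := hi.eq_of_ret rfl
    by_cases hc : c = c₁
    · subst hc
      refine ⟨.release ⟨_, _, rfl⟩ ?_ ?_ ?_, fun p _ => ?_⟩
      · simpa [release, Ctx.advance] using h.1
      · simpa [release, Ctx.advance] using h.2
      · ext a
        simp only [release, Ctx.advance, upd_self, Set.mem_insert_iff, Set.mem_sdiff,
          Set.mem_singleton_iff, Set.mem_ofPred_eq, Action.eid]
        constructor
        · rintro ⟨rfl | h, h'⟩
          · exact absurd rfl h'
          · exact ⟨h.1, h'⟩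
        · rintro ⟨h, h'⟩
          refine ⟨.inr ⟨h, ?_⟩, h'⟩
          rintro rfl
          exact h' rfl
      · simp [release, Ctx.advance]
    · refine ⟨.release ⟨_, _, rfl⟩ ?_ ?_ ?_, fun p _ => ?_⟩ <;>
        simp [release, upd_of_ne _ _ hc, Action.eid]
  | exclusiveAccess hq hA =>
    refine .upd ?_ c
    exact ⟨.exclusive hA rfl rfl rfl rfl rfl, fun p hp => by rw [hq, reqs_cons_neg _ hp]⟩
  | readOnlyAccess hq hA =>
    refine .upd ?_ c
    exact ⟨.readOnly hA rfl rfl rfl rfl rfl, fun p hp => by rw [hq, reqs_cons_neg _ hp]⟩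
  | lubExclusive _ hq hA =>
    refine .upd₂ ?_ ?_ c
    · exact ⟨.exclusive (by rw [hA]; simp) rfl rfl rfl rfl rfl,
        fun p hp => by rw [hq, reqs_cons_neg _ hp]⟩
    · exact .push rfl _
  | lubReadOnly _ hq hA =>
    refine .upd₂ ?_ ?_ c
    · exact ⟨.readOnly hA rfl rfl rfl rfl rfl, fun p hp => by rw [hq, reqs_cons_neg _ hp]⟩
    · exact .push rfl _
  | callPromotion hq _ _ =>
    refine .upd ?_ c
    exact ⟨.same rfl rfl rfl, fun p hp => by
      rw [hq, reqs_append, reqs_cons_neg _ hp, reqs_cons_neg _ hp, reqs_append]⟩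

theorem Evolves.mem_A {α : Action L} {K K' : Ctx L} (h : Evolves α K K') {a : Atv L}
    (ha : a ∈ K'.A) : a ∈ K.A ∨ a.eid = α.eid := by
  cases h.1 with
  | same hA => exact .inl (hA ▸ ha)
  | advance _ he he' _ _ hA =>
    rw [hA] at ha
    rcases ha with rfl | ha
    · exact .inr (he'.trans he)
    · exact .inl ha.1
  | exclusive _ he _ _ _ hA =>
    rw [hA] at ha
    obtain rfl : a = _ := ha
    exact .inr he
  | readOnly _ he _ _ _ hA =>
    rw [hA] at ha
    rcases ha with rfl | ha
    · exact .inr he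
    · exact .inl ha
  | release _ _ _ hA => rw [hA] at ha; exact .inl ha.1

theorem Evolves.mem_q {α : Action L} {K K' : Ctx L} (h : Evolves α K K') {r : Req L}
    (hr : r ∈ K'.q) : r ∈ K.q ∨ r.eid = α.eid := by
  by_cases he : r.eid = α.eid
  · exact .inr he
  · have := h.2 (fun x => x ≠ α.eid) (by simp)
    exact .inl (mem_reqs.1 (this ▸ mem_reqs.2 ⟨hr, he⟩)).1

theorem Step.internal_inv {E E' : Set L.EID} {G G' : Network L} {e : L.EID}
    (h : Step P (E, G) (.internal e) (E', G')) :
    E' = E ∧ (e ∈ Act G ∨ ∃ c, ∃ r ∈ (G c).q, r.eid = e) ∧ e ∈ Act G' := by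
  cases h with
  | @silent _ _ c _ _ _ _ _ _ _ _ _ ha _ =>
    refine ⟨rfl, .inl ⟨_, _, ha, rfl⟩, c, ?_⟩
    rw [upd_self]
    exact ⟨_, .inl rfl, rfl⟩
  | @synchCall _ _ c₀ c₁ _ _ _ _ _ _ _ _ _ _ _ _ hc ha _ =>
    refine ⟨rfl, .inl ⟨_, _, ha, rfl⟩, c₀, ?_⟩
    rw [upd_of_ne _ _ hc, upd_self]
    exact ⟨_, .inl rfl, rfl⟩
  | @asynchCall _ _ c₀ c₁ _ _ _ _ _ _ _ _ _ _ _ _ hc ha _ =>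
    refine ⟨rfl, .inl ⟨_, _, ha, rfl⟩, c₀, ?_⟩
    rw [upd_of_ne _ _ hc, upd_self]
    exact ⟨_, .inl rfl, rfl⟩
  | @synchReturn _ _ c₀ c₁ _ _ _ _ _ _ _ _ _ _ _ _ _ _ ha _ _ _ =>
    refine ⟨rfl, .inl ⟨_, _, ha, rfl⟩, c₁, ?_⟩
    rw [upd_self]
    exact ⟨_, .inl rfl, rfl⟩
  | @asynchReturn _ _ c _ _ _ _ _ _ _ _ _ ha _ =>
    refine ⟨rfl, .inl ⟨_, _, ha, rfl⟩, c, ?_⟩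
    rw [upd_self]
    exact ⟨_, .inl rfl, rfl⟩
  | @exclusiveAccess _ _ c _ _ _ _ _ hq _ =>
    refine ⟨rfl, .inr ⟨c, _, by rw [hq]; exact List.mem_cons_self, rfl⟩, c, ?_⟩
    rw [upd_self]
    exact ⟨_, rfl, rfl⟩
  | @readOnlyAccess _ _ c _ _ _ _ _ hq _ =>
    refine ⟨rfl, .inr ⟨c, _, by rw [hq]; exact List.mem_cons_self, rfl⟩, c, ?_⟩
    rw [upd_self]
    exact ⟨_, .inl rfl, rfl⟩
  | @lubExclusive _ _ c₀ _ _ _ _ _ hc hq _ =>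
    refine ⟨rfl, .inr ⟨c₀, _, by rw [hq]; exact List.mem_cons_self, rfl⟩, c₀, ?_⟩
    rw [upd_of_ne _ _ hc, upd_self]
    exact ⟨_, rfl, rfl⟩
  | @lubReadOnly _ _ c₀ _ _ _ _ _ hc hq _ =>
    refine ⟨rfl, .inr ⟨c₀, _, by rw [hq]; exact List.mem_cons_self, rfl⟩, c₀, ?_⟩
    rw [upd_of_ne _ _ hc, upd_self]
    exact ⟨_, .inl rfl, rfl⟩
  | @callPromotion _ _ c _ _ _ hq _ ha =>
    refine ⟨rfl, .inl ⟨_, _, ha, rfl⟩, c, ?_⟩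
    rw [upd_self]
    exact ⟨_, ha, rfl⟩

theorem Step.call_inv {E E' : Set L.EID} {G G' : Network L} {e : L.EID} {c : L.CID} {m : L.Meth}
    {vs : List (Val L)} (h : Step P (E, G) (.call e c m vs) (E', G')) :
    e ∉ E ∧ E' = insert e E := by
  cases h <;> exact ⟨by assumption, rfl⟩

theorem Step.commit_inv {E E' : Set L.EID} {G G' : Network L} {e : L.EID} {v : Val L}
    (h : Step P (E, G) (.commit e v) (E', G')) :
    E' = E \ {e} ∧ e ∈ Act G ∧ e ∉ Act G' ∧ ∀ c, ∀ r ∈ (G' c).q, r.eid ≠ e := by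
  cases h with
  | @eventReturnCommit _ G c _ _ _ _ _ _ _ _ _ ha _ hq =>
    refine ⟨rfl, ⟨_, _, ha, rfl⟩, ?_, fun c' r hr => hq c' r ?_⟩
    · rintro ⟨c', a, h, h'⟩
      exact h.2 h'
    · by_cases hc : c' = c
      · subst hc; simpa [release, Ctx.advance] using hr
      · simpa [release, upd_of_ne _ _ hc] using hr

/-! ### Locks are held until the commit -/

/-- Up to its commit, an event keeps each lock that it has acquired. -/
theorem Evolves.persists {α : Action L} {K K' : Ctx L} (h : Evolves α K K') {a : Atv L}
    (ha : a ∈ K.A) (hα : α.IsCommit → a.eid ≠ α.eid) :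
    ∃ a' ∈ K'.A, a'.eid = a.eid ∧ a'.mode = a.mode := by
  cases h.1 with
  | same hA => exact ⟨a, hA ▸ ha, rfl, rfl⟩
  | @advance b b' _ _ he' hm _ hA =>
    by_cases hab : a = b
    · subst hab
      exact ⟨b', by rw [hA]; exact .inl rfl, he', hm⟩
    · exact ⟨a, by rw [hA]; exact .inr ⟨ha, hab⟩, rfl, rfl⟩
  | @exclusive a' hK he hm _ _ hA =>
    exact ⟨a', by rw [hA]; rfl, he.trans (hK a ha).1.symm, hm.trans (hK a ha).2.symm⟩
  | readOnly _ _ _ _ _ hA => exact ⟨a, by rw [hA]; exact .inr ha, rfl, rfl⟩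
  | release hc _ _ hA => exact ⟨a, by rw [hA]; exact ⟨ha, hα hc⟩, rfl, rfl⟩

/-- An exclusive lock of a context instance excludes all other events from it. -/
def Exclusion (G : Network L) : Prop :=
  ∀ c, ∀ a ∈ (G c).A, ∀ b ∈ (G c).A, a.mode = .ex → b.eid = a.eid

theorem Exclusion.step {E E' : Set L.EID} {G G' : Network L} {α : Action L} (hG : Exclusion G)
    (h : Step P (E, G) α (E', G')) : Exclusion G' := by
  intro c
  specialize hG c
  cases (h.evolves c).1 with
  | same hA => rwa [hA]
  | @advance b b' hb _ he' hm _ hA =>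
    rw [hA]
    rintro x (rfl | ⟨hx, -⟩) y (rfl | ⟨hy, -⟩) hex
    · rfl
    · exact (hG b hb y hy (hm ▸ hex)).trans he'.symm
    · exact he'.trans (hG x hx b hb hex)
    · exact hG x hx y hy hex
  | exclusive _ _ _ _ _ hA =>
    rw [hA]
    rintro x rfl y rfl _
    rfl
  | readOnly hK _ hm _ _ hA =>
    rw [hA]
    rintro x (rfl | hx) y _ hex
    · rw [hm] at hex
      exact nomatch hex
    · exact absurd hex (hK x hx)
  | release _ _ _ hA =>
    rw [hA]
    exact fun x hx y hy => hG x hx.1 y hy.1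

/-- Every context instance is still as in `G₀`, or it is locked in exclusive mode. -/
def Untouched (G₀ G : Network L) : Prop :=
  ∀ c, (∃ a ∈ (G c).A, a.mode = .ex) ∨ (G c).st = (G₀ c).st ∧ (G c).ge = (G₀ c).ge

theorem Untouched.step {E E' : Set L.EID} {G₀ G G' : Network L} {α : Action L}
    (hG : Untouched G₀ G) (h : Step P (E, G) α (E', G')) (hα : ¬ α.IsCommit) :
    Untouched G₀ G' := by
  intro c
  have hev := h.evolves c
  rcases hG c with ⟨a, ha, hex⟩ | hst
  · obtain ⟨a', ha', -, hm⟩ := hev.persists ha (fun h => absurd h hα)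
    exact .inl ⟨a', ha', hm.trans hex⟩
  · cases hev.1 with
    | same _ h₁ h₂ => exact .inr ⟨h₁.trans hst.1, h₂.trans hst.2⟩
    | @advance b b' _ _ _ hm hro hA =>
      cases hb : b.mode with
      | ro => exact .inr ⟨(hro hb).1.trans hst.1, (hro hb).2.trans hst.2⟩
      | ex => exact .inl ⟨b', by rw [hA]; exact .inl rfl, hm.trans hb⟩
    | exclusive _ _ _ h₁ h₂ => exact .inr ⟨h₁.trans hst.1, h₂.trans hst.2⟩
    | readOnly _ _ _ h₁ h₂ => exact .inr ⟨h₁.trans hst.1, h₂.trans hst.2⟩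
    | release _ h₁ h₂ => exact .inr ⟨h₁.trans hst.1, h₂.trans hst.2⟩

theorem Exec.persists {X Y : Config L} {T : List (Action L)} (h : Exec P X T Y)
    (hT : ∀ α ∈ T, ¬ α.IsCommit) {c : L.CID} {a : Atv L} (ha : a ∈ (X.2 c).A) :
    ∃ a' ∈ (Y.2 c).A, a'.eid = a.eid ∧ a'.mode = a.mode := by
  induction h generalizing a with
  | nil => exact ⟨a, ha, rfl, rfl⟩
  | @cons X α Y T Z hs _ ih =>
    obtain ⟨a', ha', he, hm⟩ :=
      (hs.evolves c).persists ha (fun h => absurd h (hT _ List.mem_cons_self))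
    obtain ⟨b, hb, he', hm'⟩ := ih (fun β hβ => hT β (List.mem_cons_of_mem _ hβ)) ha'
    exact ⟨b, hb, he'.trans he, hm'.trans hm⟩

/-! ### Running events -/

/-- All requests and activations are those of running events. -/
def Tracked (X : Config L) : Prop :=
  (∀ e ∈ Act X.2, e ∈ X.1) ∧ ∀ c, ∀ r ∈ (X.2 c).q, r.eid ∈ X.1

theorem Tracked.of_quiescent {G : Network L} (hG : Quiescent G) : Tracked (∅, G) := by
  constructor
  · rintro e ⟨c, a, ha, -⟩
    simp [(hG c).2] at ha
  · intro c r hr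
    simp [(hG c).1] at hr

theorem Tracked.mem_of_not_isCall {X Y : Config L} {α : Action L} (hX : Tracked X)
    (h : Step P X α Y) (hα : ¬ α.IsCall) : α.eid ∈ X.1 := by
  cases α with
  | internal e =>
    rcases h.internal_inv.2.1 with h | ⟨c, r, hr, rfl⟩
    · exact hX.1 e h
    · exact hX.2 c r hr
  | call e c m vs => exact absurd ⟨_, _, _, _, rfl⟩ hα
  | commit e v => exact hX.1 e h.commit_inv.2.1

theorem Tracked.step {X Y : Config L} {α : Action L} (hX : Tracked X) (h : Step P X α Y) :
    Tracked Y := by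
  have hA : ∀ e ∈ Act Y.2, e ∈ X.1 ∨ e = α.eid := by
    rintro _ ⟨c, a, ha, rfl⟩
    exact ((h.evolves c).mem_A ha).imp_left fun ha => hX.1 _ ⟨c, a, ha, rfl⟩
  have hq : ∀ c, ∀ r ∈ (Y.2 c).q, r.eid ∈ X.1 ∨ r.eid = α.eid := fun c r hr =>
    ((h.evolves c).mem_q hr).imp_left (hX.2 c r)
  cases α with
  | internal e =>
    have he := hX.mem_of_not_isCall h (by rintro ⟨_, _, _, _, h⟩; cases h)
    rw [Tracked, h.internal_inv.1]
    exact ⟨fun e' h' => (hA e' h').elim id fun h => h ▸ he,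
      fun c r hr => (hq c r hr).elim id fun h => h ▸ he⟩
  | call e c m vs =>
    rw [Tracked, h.call_inv.2]
    exact ⟨fun e' h' => (hA e' h').symm, fun c r hr => (hq c r hr).symm⟩
  | commit e v =>
    obtain ⟨hE, -, h₁, h₂⟩ := h.commit_inv
    rw [Tracked, hE]
    refine ⟨fun e' h' => ?_, fun c r hr => ?_⟩
    · have : e' ≠ e := by rintro rfl; exact h₁ h'
      exact ⟨(hA e' h').resolve_right this, this⟩
    · exact ⟨(hq c r hr).resolve_right (h₂ c r hr), h₂ c r hr⟩

/-- At position `i` of `T` there is the call of the event `e`, and `e` is not called or committed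
later. -/
def PendingAt (T : List (Action L)) (i : ℕ) (e : L.EID) (c : L.CID) (m : L.Meth)
    (vs : List (Val L)) : Prop :=
  T[i]? = some (.call e c m vs) ∧
    ∀ j γ, i < j → T[j]? = some γ → γ.eid = e → ¬ γ.IsCall ∧ ¬ γ.IsCommit

theorem getElem?_snoc_eq_some {A : Type*} {T : List A} {a b : A} {j : ℕ} :
    (T ++ [a])[j]? = some b ↔ T[j]? = some b ∨ j = T.length ∧ a = b := by
  rcases lt_trichotomy j T.length with h | rfl | h
  · rw [List.getElem?_append_left h]
    simp [h.ne]
  · simp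
  · rw [List.getElem?_append_right h.le]
    have h₁ : T[j]? = none := by simp [h.le]
    have h₂ : ([a] : List A)[j - T.length]? = none := by simp; omega
    simp [h₁, h₂, h.ne']

theorem lt_length_of_getElem? {A : Type*} {T : List A} {a : A} {j : ℕ} (h : T[j]? = some a) :
    j < T.length := (List.getElem?_eq_some_iff.1 h).1

theorem PendingAt.snoc {T : List (Action L)} {i : ℕ} {e : L.EID} {c : L.CID} {m : L.Meth}
    {vs : List (Val L)} (h : PendingAt T i e c m vs) {α : Action L}
    (hα : α.eid = e → ¬ α.IsCall ∧ ¬ α.IsCommit) : PendingAt (T ++ [α]) i e c m vs := by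
  refine ⟨getElem?_snoc_eq_some.2 (.inl h.1), fun j γ hj hγ he => ?_⟩
  rcases getElem?_snoc_eq_some.1 hγ with hγ | ⟨-, rfl⟩
  · exact h.2 j γ hj hγ he
  · exact hα he

theorem PendingAt.self (T : List (Action L)) (e : L.EID) (c : L.CID) (m : L.Meth)
    (vs : List (Val L)) : PendingAt (T ++ [.call e c m vs]) T.length e c m vs := by
  refine ⟨getElem?_snoc_eq_some.2 (.inr ⟨rfl, rfl⟩), fun j γ hj hγ _ => ?_⟩
  have := lt_length_of_getElem? hγ
  simp at this
  omega

theorem PendingAt.belongs {T : List (Action L)} {i : ℕ} {c : L.CID} {m : L.Meth}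
    {vs : List (Val L)} {α : Action L} (h : PendingAt T i α.eid c m vs) (hα : ¬ α.IsCall) :
    Belongs (T ++ [α]) i T.length := by
  refine ⟨lt_length_of_getElem? h.1, _, α, getElem?_snoc_eq_some.2 (.inl h.1),
    getElem?_snoc_eq_some.2 (.inr ⟨rfl, rfl⟩), ⟨_, _, _, _, rfl⟩, hα, rfl, ?_⟩
  intro j γ hij hj hγ he
  refine h.2 j γ hij ?_ he
  rcases getElem?_snoc_eq_some.1 hγ with hγ | ⟨rfl, -⟩
  · exact hγ
  · omega

theorem Belongs.append {T : List (Action L)} {i k : ℕ} (h : Belongs T i k)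
    (T' : List (Action L)) : Belongs (T ++ T') i k := by
  obtain ⟨hik, α, β, hα, hβ, h₁, h₂, h₃, h₄⟩ := h
  have hk := lt_length_of_getElem? hβ
  refine ⟨hik, α, β, ?_, ?_, h₁, h₂, h₃, fun j γ hij hj hγ => h₄ j γ hij hj ?_⟩
  · rwa [List.getElem?_append_left (hik.trans hk)]
  · rwa [List.getElem?_append_left hk]
  · rwa [List.getElem?_append_left (hj.trans hk)] at hγ

theorem Exec.tracked {G₀ : Network L} (h₀ : Quiescent G₀) {T : List (Action L)} {X : Config L}
    (h : Exec P (∅, G₀) T X) : Tracked X := by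
  induction h using Run.snoc_induction with
  | nil => exact .of_quiescent h₀
  | snoc T Y α Z _ hs ih => exact ih.step hs

theorem Exec.exists_pendingAt {G₀ : Network L} {T : List (Action L)}
    {X : Config L} (h : Exec P (∅, G₀) T X) :
    ∀ e ∈ X.1, ∃ i c m vs, PendingAt T i e c m vs := by
  induction h using Run.snoc_induction with
  | nil => exact fun e he => absurd he (Set.notMem_empty e)
  | snoc T Y α Z _ hs ih =>
    intro e he
    cases α with
    | internal e' =>
      rw [hs.internal_inv.1] at he
      obtain ⟨i, c, m, vs, h⟩ := ih e he
      refine ⟨i, c, m, vs, h.snoc fun _ => ⟨?_, ?_⟩⟩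
      · rintro ⟨_, _, _, _, h⟩; cases h
      · rintro ⟨_, _, h⟩; cases h
    | call e' c m vs =>
      by_cases hee : e = e'
      · subst hee
        exact ⟨_, c, m, vs, .self T e c m vs⟩
      · rw [hs.call_inv.2] at he
        obtain ⟨i, c, m, vs, h⟩ := ih e (he.resolve_left hee)
        exact ⟨i, c, m, vs, h.snoc fun h => absurd h.symm hee⟩
    | commit e' v =>
      rw [hs.commit_inv.1] at he
      obtain ⟨i, c, m, vs, h⟩ := ih e he.1
      exact ⟨i, c, m, vs, h.snoc fun h => absurd h.symm he.2⟩

/-! ### The linear semantics -/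

theorem LinExec.exec {X Y : Config L} {T : List (Action L)} (h : LinExec P X T Y) :
    Exec P X T Y :=
  h.mono fun _ _ _ h => h.2.1

/-- Between an internal step of an event and its commit, the event stays activated. -/
theorem Exec.mem_act_of_internal {X Y Z : Config L} {e : L.EID} {T : List (Action L)}
    (h : Step P X (.internal e) Y) (h' : Exec P Y T Z)
    (hT : ∀ α ∈ T, α.eid = e → ¬ α.IsCommit) : e ∈ Act Z.2 := by
  induction h' using Run.snoc_induction with
  | nil => exact h.internal_inv.2.2
  | snoc T Y α Z _ hs ih =>
    obtain ⟨c, a, ha, rfl⟩ := ih fun β hβ => hT β (List.mem_append_left _ hβ)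
    obtain ⟨a', ha', he, -⟩ := (hs.evolves c).persists ha fun hα h =>
      hT α (List.mem_append_right _ List.mem_cons_self) h.symm hα
    exact ⟨c, a', ha', he⟩

theorem LinExec.isolated {X Y : Config L} {T : List (Action L)} (h : LinExec P X T Y) :
    Isolated T := by
  intro i j k e α β hij hjk hi hj _ _ _ hc
  obtain ⟨Z, Z', -, hs, hr⟩ := h.split_at hi
  have hj' : (T.drop (i + 1))[j - (i + 1)]? = some β := by
    rw [List.getElem?_drop, ← hj]
    congr 1
    omega
  obtain ⟨W, W', hr', hs', -⟩ := hr.split_at hj'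
  have he : e ∈ Act W.2 := by
    refine Exec.mem_act_of_internal hs.2.1 (LinExec.exec hr') fun γ hγ => ?_
    obtain ⟨l, hl, rfl⟩ := List.mem_iff_getElem.1 hγ
    simp only [List.length_take, List.length_drop, lt_min_iff] at hl
    refine hc (i + 1 + l) _ (by omega) (by omega) ?_
    simp only [List.getElem_take, List.getElem_drop]
    exact List.getElem?_eq_getElem _
  cases β with
  | internal e' =>
    obtain ⟨c, a, ha, rfl⟩ := he
    obtain ⟨a', ha', he', -⟩ := (hs'.2.1.evolves c).persists ha (by rintro ⟨_, _, h⟩; cases h)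
    exact .inr (hs'.2.2 hs'.2.1.internal_inv.2.2 ⟨c, a', ha', he'⟩)
  | call => exact .inl ⟨_, _, _, _, rfl⟩
  | commit e' v => exact .inr (hs'.1 hs'.2.1.commit_inv.2.1 he)

theorem Exec.keepsOrder {G₀ : Network L} (h₀ : Quiescent G₀) {X : Config L}
    {T : List (Action L)} (h : Exec P (∅, G₀) T X) : KeepsOrder T := by
  constructor
  · intro k α hk hα
    obtain ⟨Z, Z', hr, hs, -⟩ := h.split_at hk
    obtain ⟨i, c, m, vs, hp⟩ :=
      Exec.exists_pendingAt hr _ ((Exec.tracked h₀ hr).mem_of_not_isCall hs hα)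
    have hlt := lt_length_of_getElem? hk
    have hb := (hp.belongs hα).append (T.drop (k + 1))
    have hT : T.take k ++ [α] ++ T.drop (k + 1) = T := by
      obtain rfl : T[k] = α := by simpa [hlt] using hk
      simp
    rw [hT, List.length_take, min_eq_left hlt.le] at hb
    exact ⟨i, hb⟩
  · intro i j i' α hij hj hα hji k k' hk hk'
    obtain ⟨h₁, β, γ, hβ, hγ, -, -, hβγ, -⟩ := hij
    obtain ⟨-, β', γ', hβ', hγ', -, -, -, hk⟩ := hk
    obtain rfl : γ = α := Option.some_injective _ (hγ.symm.trans hj)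
    obtain rfl : β' = β := Option.some_injective _ (hβ'.symm.trans hβ)
    have := hk'.1
    by_contra! hlt
    exact (hk j γ h₁ (by omega) hj hβγ.symm).2 hα

/-! ### Restricting executions to some of the events -/

open Classical in
/-- The part of a context instance that concerns the events satisfying `p`. Its store and global
environment are those of `K` if `v` holds, and those of the fixed `F` otherwise. -/
noncomputable def Ctx.restrict (p : L.EID → Prop) (v : Prop) (K F : Ctx L) : Ctx L where
  q := reqs p K.q
  st := if v then K.st else F.st
  ge := if v then K.ge else F.ge
  A := {a ∈ K.A | p a.eid}

/-- The part of a network that concerns the events satisfying `p`. The stores and global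
environments evolve as in `G` for the context instances in `V`, and are frozen as in `F` for the
other ones. -/
noncomputable def restrict (p : L.EID → Prop) (V : Set L.CID) (F G : Network L) : Network L :=
  fun c => (G c).restrict p (c ∈ V) (F c)

/-- Conditions under which the events satisfying `p` do not see the difference between `G` and
its restriction: they at most read what is frozen, and the other events at most read what is
not. -/
structure Separated (p : L.EID → Prop) (V : Set L.CID) (F G : Network L) : Prop where
  frozen : ∀ c, c ∉ V → ∀ a ∈ (G c).A, p a.eid →
    a.mode = .ro ∧ (G c).st = (F c).st ∧ (G c).ge = (F c).ge
  live : ∀ c, c ∈ V → ∀ a ∈ (G c).A, ¬ p a.eid → a.mode = .ro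

section

variable {p : L.EID → Prop} {V : Set L.CID} {F G : Network L}

theorem restrict_upd (c : L.CID) (K : Ctx L) :
    restrict p V F (upd G c K) = upd (restrict p V F G) c (K.restrict p (c ∈ V) (F c)) := by
  funext c'
  by_cases h : c' = c
  · subst h; simp [restrict]
  · simp [restrict, upd_of_ne _ _ h]

theorem Ctx.restrict_push {v : Prop} {F K : Ctx L} {r : Req L} (hr : p r.eid) :
    (K.push r).restrict p v F = (K.restrict p v F).push r := by
  simp [Ctx.restrict, Ctx.push, reqs, hr]

theorem Ctx.restrict_advance {v : Prop} {F K : Ctx L} {st : Store L} {ge : Env L} {a a' : Atv L}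
    (ha' : p a'.eid) (hv : ¬ v → st = F.st ∧ ge = F.ge) :
    (K.advance st ge a a').restrict p v F = (K.restrict p v F).advance st ge a a' := by
  have hA : {x ∈ insert a' (K.A \ {a}) | p x.eid} = insert a' ({x ∈ K.A | p x.eid} \ {a}) := by
    ext x
    simp only [Set.mem_ofPred_eq, Set.mem_insert_iff, Set.mem_sdiff, Set.mem_singleton_iff]
    constructor
    · rintro ⟨rfl | h, hx⟩
      · exact .inl rfl
      · exact .inr ⟨⟨h.1, hx⟩, h.2⟩
    · rintro (rfl | h)
      · exact ⟨.inl rfl, ha'⟩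
      · exact ⟨.inr ⟨h.1.1, h.2⟩, h.1.2⟩
  by_cases h : v
  · simp only [Ctx.restrict, Ctx.advance, if_pos h, hA]
  · simp only [Ctx.restrict, Ctx.advance, if_neg h, hA, hv h]

theorem Separated.st_eq (hG : Separated p V F G) {c : L.CID} {a : Atv L} (ha : a ∈ (G c).A)
    (he : p a.eid) : (restrict p V F G c).st = (G c).st ∧ (restrict p V F G c).ge = (G c).ge := by
  by_cases h : c ∈ V
  · simp [restrict, Ctx.restrict, h]
  · have := hG.frozen c h a ha he
    simp [restrict, Ctx.restrict, h, this]

theorem Separated.intra (hG : Separated p V F G) {c : L.CID} {a : Atv L} (ha : a ∈ (G c).A)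
    (he : p a.eid) {le : List (Env L)} {s : Cmd L} {ℓ : Label L} {Y : Local L}
    (h : Intra P c a.mode ⟨(G c).st, (G c).ge, le, s⟩ ℓ Y) :
    Intra P c a.mode ⟨(restrict p V F G c).st, (restrict p V F G c).ge, le, s⟩ ℓ Y := by
  rwa [(hG.st_eq ha he).1, (hG.st_eq ha he).2]

theorem Separated.intra_frozen (hG : Separated p V F G) {c : L.CID} {a : Atv L}
    (ha : a ∈ (G c).A) (he : p a.eid) {le : List (Env L)} {s : Cmd L} {ℓ : Label L} {Y : Local L}
    (h : Intra P c a.mode ⟨(G c).st, (G c).ge, le, s⟩ ℓ Y) :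
    c ∉ V → Y.st = (F c).st ∧ Y.ge = (F c).ge := by
  intro hc
  obtain ⟨hm, h₁, h₂⟩ := hG.frozen c hc a ha he
  obtain ⟨h₃, h₄⟩ := h.eq_of_ro hm
  exact ⟨h₃.trans h₁, h₄.trans h₂⟩

theorem restrict_release (e : L.EID) :
    restrict p V F (release e G) = release e (restrict p V F G) := by
  funext c
  simp only [restrict, Ctx.restrict, release, Ctx.mk.injEq, true_and]
  ext a
  exact ⟨fun h => ⟨⟨h.1.1, h.2⟩, h.1.2⟩, fun h => ⟨⟨h.1.1, h.2⟩, h.1.2⟩⟩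

theorem setOf_mem_insert_and {e : L.EID} (he : p e) (E : Set L.EID) :
    {x ∈ insert e E | p x} = insert e {x ∈ E | p x} := by
  ext x
  constructor
  · rintro ⟨rfl | h, hx⟩
    · exact .inl rfl
    · exact .inr ⟨h, hx⟩
  · rintro (rfl | h)
    · exact ⟨.inl rfl, he⟩
    · exact ⟨.inr h.1, h.2⟩

/-- A step of an event satisfying `p` can be made without the other events. -/
theorem Step.restrict {E E' : Set L.EID} {G' : Network L} {α : Action L}
    (h : Step P (E, G) α (E', G')) (hG : Separated p V F G) (hα : p α.eid) :
    Step P ({e ∈ E | p e}, restrict p V F G) α ({e ∈ E' | p e}, restrict p V F G') := by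
  cases h with
  | silent ha hi =>
    rw [restrict_upd, Ctx.restrict_advance hα (hG.intra_frozen ha hα hi)]
    exact .silent ⟨ha, hα⟩ (hG.intra ha hα hi)
  | synchCall hch hc ha hi =>
    rw [restrict_upd, restrict_upd, Ctx.restrict_advance hα (hG.intra_frozen ha hα hi),
      Ctx.restrict_push (by exact hα)]
    exact .synchCall hch hc ⟨ha, hα⟩ (hG.intra ha hα hi)
  | asynchCall hch hc ha hi =>
    rw [restrict_upd, restrict_upd, Ctx.restrict_advance hα (hG.intra_frozen ha hα hi),
      Ctx.restrict_push (by exact hα)]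
    exact .asynchCall hch hc ⟨ha, hα⟩ (hG.intra ha hα hi)
  | @synchReturn _ _ c₀ c₁ _ _ _ _ _ _ _ _ _ _ _ _ _ hc ha hi ha' hw =>
    have hst := hG.st_eq ha' hα
    rw [restrict_upd, restrict_upd,
      Ctx.restrict_advance hα fun h => (hG.frozen c₀ h _ ha' hα).2,
      Ctx.restrict_advance hα (hG.intra_frozen ha hα hi), ← hst.1, ← hst.2]
    exact .synchReturn hc ⟨ha, hα⟩ (hG.intra ha hα hi) ⟨ha', hα⟩ hw
  | asynchReturn ha hi =>
    rw [restrict_upd, Ctx.restrict_advance hα (hG.intra_frozen ha hα hi)]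
    exact .asynchReturn ⟨ha, hα⟩ (hG.intra ha hα hi)
  | eventCallUnshared he hl =>
    rw [restrict_upd, Ctx.restrict_push (by exact hα), setOf_mem_insert_and (by exact hα)]
    exact .eventCallUnshared (fun h => he h.1) hl
  | eventCallShared he hl =>
    rw [restrict_upd, Ctx.restrict_push (by exact hα), setOf_mem_insert_and (by exact hα)]
    exact .eventCallShared (fun h => he h.1) hl
  | @eventReturnCommit _ _ c e _ _ _ _ _ _ _ _ ha hi hq =>
    have hE : {x ∈ E \ {e} | p x} = {x ∈ E | p x} \ {e} := by
      ext x
      exact ⟨fun h => ⟨⟨h.1.1, h.2⟩, h.1.2⟩, fun h => ⟨⟨h.1.1, h.2⟩, h.1.2⟩⟩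
    rw [restrict_release, restrict_upd, Ctx.restrict_advance hα (hG.intra_frozen ha hα hi), hE]
    exact .eventReturnCommit ⟨ha, hα⟩ (hG.intra ha hα hi)
      fun c' r hr => hq c' r (mem_reqs.1 hr).1
  | @exclusiveAccess _ _ c e m vs d q' hq hA =>
    have hs := Step.exclusiveAccess (P := P) (E := {e ∈ E | p e}) (G := Aeon.restrict p V F G)
      (c := c) (e := e) (m := m) (vs := vs) (d := d) (q' := reqs p q')
      (by rw [← reqs_cons_pos _ (by exact hα), ← hq]; rfl) fun a ha => hA a ha.1
    convert hs using 2
    rw [restrict_upd]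
    congr 1
    simp only [Ctx.restrict, Aeon.restrict, Ctx.mk.injEq, true_and]
    ext a
    exact ⟨fun h => h.1, fun h => ⟨h, by obtain rfl : a = _ := h; exact hα⟩⟩
  | @readOnlyAccess _ _ c e m vs d q' hq hA =>
    have hs := Step.readOnlyAccess (P := P) (E := {e ∈ E | p e}) (G := Aeon.restrict p V F G)
      (c := c) (e := e) (m := m) (vs := vs) (d := d) (q' := reqs p q')
      (by rw [← reqs_cons_pos _ (by exact hα), ← hq]; rfl) fun a ha => hA a ha.1
    convert hs using 2
    rw [restrict_upd]
    congr 1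
    simp only [Ctx.restrict, Aeon.restrict, Ctx.mk.injEq, true_and]
    ext a
    constructor
    · rintro ⟨rfl | h, h'⟩
      exacts [.inl rfl, .inr ⟨h, h'⟩]
    · rintro (rfl | h)
      exacts [⟨.inl rfl, hα⟩, ⟨.inr h.1, h.2⟩]
  | @lubExclusive _ _ c₀ c e m vs q' hc hq hA =>
    have hs := Step.lubExclusive (P := P) (E := {e ∈ E | p e}) (G := Aeon.restrict p V F G)
      (c₀ := c₀) (c := c) (e := e) (m := m) (vs := vs) (q' := reqs p q') hc
      (by rw [← reqs_cons_pos _ (by exact hα), ← hq]; rfl)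
      (by simp [Aeon.restrict, Ctx.restrict, hA])
    convert hs using 2
    rw [restrict_upd, restrict_upd, Ctx.restrict_push (by exact hα)]
    congr 2
    simp only [Ctx.restrict, Aeon.restrict, Ctx.mk.injEq, true_and]
    ext a
    exact ⟨fun h => h.1, fun h => ⟨h, by obtain rfl : a = _ := h; exact hα⟩⟩
  | @lubReadOnly _ _ c₀ c e m vs q' hc hq hA =>
    have hs := Step.lubReadOnly (P := P) (E := {e ∈ E | p e}) (G := Aeon.restrict p V F G)
      (c₀ := c₀) (c := c) (e := e) (m := m) (vs := vs) (q' := reqs p q') hc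
      (by rw [← reqs_cons_pos _ (by exact hα), ← hq]; rfl) fun a ha => hA a ha.1
    convert hs using 2
    rw [restrict_upd, restrict_upd, Ctx.restrict_push (by exact hα)]
    congr 2
    simp only [Ctx.restrict, Aeon.restrict, Ctx.mk.injEq, true_and]
    ext a
    constructor
    · rintro ⟨rfl | h, h'⟩
      exacts [.inl rfl, .inr ⟨h, h'⟩]
    · rintro (rfl | h)
      exacts [⟨.inl rfl, hα⟩, ⟨.inr h.1, h.2⟩]
  | @callPromotion _ _ c q₀ r q₁ hq hr ha =>
    have hs := Step.callPromotion (P := P) (E := {e ∈ E | p e}) (G := Aeon.restrict p V F G)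
      (c := c) (q₀ := reqs p q₀) (r := r) (q₁ := reqs p q₁)
      (by rw [← reqs_cons_pos _ (by exact hα), ← reqs_append, ← hq]; rfl)
      (fun r' h => hr r' (mem_reqs.1 h).1) ⟨ha, hα⟩
    convert hs using 2
    rw [restrict_upd]
    congr 1
    simp only [Ctx.restrict, Aeon.restrict, Ctx.mk.injEq, and_true]
    rw [reqs_cons_pos _ (by exact hα), reqs_append]

/-- A step of an event that does not satisfy `p` cannot be seen in the restriction. -/
theorem Step.restrict_eq {E E' : Set L.EID} {G' : Network L} {α : Action L}
    (h : Step P (E, G) α (E', G')) (hG : Separated p V F G) (hα : ¬ p α.eid) :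
    Aeon.restrict p V F G' = Aeon.restrict p V F G := by
  funext c
  have hev := h.evolves c
  have hlive := hG.live c
  suffices H : {a ∈ (G' c).A | p a.eid} = {a ∈ (G c).A | p a.eid} ∧
      (c ∈ V → (G' c).st = (G c).st ∧ (G' c).ge = (G c).ge) by
    simp only [Aeon.restrict, Ctx.restrict, hev.2 p hα, H.1]
    by_cases hc : c ∈ V
    · simp [hc, H.2 hc]
    · simp [hc]
  cases hev.1 with
  | same hA h₁ h₂ => exact ⟨by rw [hA], fun _ => ⟨h₁, h₂⟩⟩
  | @advance b b' hb he he' _ hro hA =>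
    refine ⟨?_, fun hc => hro (hlive hc b hb (he ▸ hα))⟩
    rw [hA]
    ext a
    constructor
    · rintro ⟨rfl | h, h'⟩
      · exact absurd (he ▸ he' ▸ h') hα
      · exact ⟨h.1, h'⟩
    · rintro ⟨h, h'⟩
      refine ⟨.inr ⟨h, ?_⟩, h'⟩
      rintro rfl
      exact hα (he ▸ h')
  | exclusive hK he _ h₁ h₂ hA =>
    refine ⟨?_, fun _ => ⟨h₁, h₂⟩⟩
    rw [hA]
    ext a
    constructor
    · rintro ⟨rfl, h'⟩
      exact absurd (he ▸ h') hα
    · rintro ⟨h, h'⟩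
      exact absurd ((hK a h).1 ▸ h') hα
  | readOnly _ he _ h₁ h₂ hA =>
    refine ⟨?_, fun _ => ⟨h₁, h₂⟩⟩
    rw [hA]
    ext a
    constructor
    · rintro ⟨rfl | h, h'⟩
      · exact absurd (he ▸ h') hα
      · exact ⟨h, h'⟩
    · rintro ⟨h, h'⟩
      exact ⟨.inr h, h'⟩
  | release _ h₁ h₂ hA =>
    refine ⟨?_, fun _ => ⟨h₁, h₂⟩⟩
    rw [hA]
    ext a
    constructor
    · rintro ⟨h, h'⟩
      exact ⟨h.1, h'⟩
    · rintro ⟨h, h'⟩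
      refine ⟨⟨h, ?_⟩, h'⟩
      intro he
      exact hα (he ▸ h')

theorem Step.setOf_mem_and_eq {E E' : Set L.EID} {G' : Network L} {α : Action L}
    (h : Step P (E, G) α (E', G')) (hα : ¬ p α.eid) : {e ∈ E' | p e} = {e ∈ E | p e} := by
  cases α with
  | internal e => rw [h.internal_inv.1]
  | call e c m vs =>
    rw [h.call_inv.2]
    ext x
    refine ⟨fun hx => ⟨hx.1.resolve_left ?_, hx.2⟩, fun hx => ⟨.inr hx.1, hx.2⟩⟩
    rintro rfl
    exact hα hx.2
  | commit e v =>
    rw [h.commit_inv.1]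
    ext x
    refine ⟨fun hx => ⟨hx.1.1, hx.2⟩, fun hx => ⟨⟨hx.1, ?_⟩, hx.2⟩⟩
    rintro rfl
    exact hα hx.2

end

open Classical in
/-- The actions of the events that satisfy `p`, in their order. -/
noncomputable def acts (p : L.EID → Prop) (T : List (Action L)) : List (Action L) :=
  T.filter fun α => decide (p α.eid)

/-- The restriction of an execution all of whose states are separated. These states are given as
the ones that satisfy an invariant `I` and from which the final state `Y` can be reached. -/
theorem Exec.restrict {p : L.EID → Prop} {V : Set L.CID} {F : Network L} {I : Network L → Prop}
    {X Y : Config L} {T : List (Action L)} (h : Exec P X T Y) (hT : ∀ α ∈ T, ¬ α.IsCommit)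
    (hX : I X.2)
    (hI : ∀ E G α E' G', I G → Step P (E, G) α (E', G') → ¬ α.IsCommit → I G')
    (hsep : ∀ (Z : Config L) T', I Z.2 → Exec P Z T' Y → (∀ α ∈ T', ¬ α.IsCommit) →
      Separated p V F Z.2) :
    Exec P ({e ∈ X.1 | p e}, Aeon.restrict p V F X.2) (acts p T)
      ({e ∈ Y.1 | p e}, Aeon.restrict p V F Y.2) := by
  induction h with
  | nil => exact .nil
  | @cons X α Z T Y hs hr ih =>
    have hX' := hsep X _ hX (.cons hs hr) hT
    obtain ⟨hα, hT⟩ := List.forall_mem_cons.1 hT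
    have := ih hT (hI _ _ _ _ _ hX hs hα) hsep
    by_cases hp : p α.eid
    · simpa [acts, hp] using Run.cons (hs.restrict hX' hp) this
    · rw [hs.restrict_eq hX' hp, hs.setOf_mem_and_eq hp] at this
      simpa [acts, hp] using this

/-! ### Serializing the next event that commits -/

theorem Ctx.ext {K K' : Ctx L} (hq : K.q = K'.q) (hst : K.st = K'.st) (hge : K.ge = K'.ge)
    (hA : K.A = K'.A) : K = K' := by
  cases K
  cases K'
  simp_all

theorem Exclusion.of_quiescent {G : Network L} (hG : Quiescent G) : Exclusion G := by
  intro c a ha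
  simp [(hG c).2] at ha

theorem Step.eq_of_mem_act {X Y : Config L} {α : Action L} (h : Step P X α Y)
    (hX : ∀ e ∈ Act X.2, e = α.eid) : ∀ e ∈ Act Y.2, e = α.eid := by
  rintro _ ⟨c, a, ha, rfl⟩
  exact ((h.evolves c).mem_A ha).elim (fun ha => hX _ ⟨c, a, ha, rfl⟩) id

/-- An execution all of whose steps are made by a single event belongs to the linear semantics. -/
theorem Exec.linExec {X Y : Config L} {T : List (Action L)} {e : L.EID} (h : Exec P X T Y)
    (hT : ∀ α ∈ T, α.eid = e) (hX : ∀ e' ∈ Act X.2, e' = e) : LinExec P X T Y := by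
  induction h with
  | nil => exact .nil
  | @cons X α Z T Y hs _ ih =>
    obtain ⟨rfl, hT⟩ := List.forall_mem_cons.1 hT
    have hZ := Step.eq_of_mem_act hs hX
    exact .cons ⟨fun x hx y hy => (hX x hx).trans (hX y hy).symm, hs,
      fun x hx y hy => (hZ x hx).trans (hZ y hy).symm⟩ (ih hT hZ)

/-- In an execution from a quiescent network, the first event that commits can be run ahead of all
the other ones: two-phase locking makes the restriction to this event and the
restriction to the other events independent of each other. -/
theorem Exec.extract {G₁ G G' : Network L} (h₁ : Quiescent G₁) {T : List (Action L)}
    {E E' : Set L.EID} {e : L.EID} {v : Val L} (h : Exec P (∅, G₁) T (E, G))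
    (hT : ∀ α ∈ T, ¬ α.IsCommit) (hs : Step P (E, G) (.commit e v) (E', G')) :
    ∃ G₂ : Network L, Quiescent G₂ ∧
      LinExec P (∅, G₁) (acts (· = e) T ++ [.commit e v]) (∅, G₂) ∧
      Exec P (∅, G₂) (acts (· ≠ e) T) (E', G') := by
  -- the context instances that `e` may have modified
  let W : Set L.CID := {c | ∃ a ∈ (G c).A, a.eid = e ∧ a.mode = .ex}
  let I : Network L → Prop := fun Z => Exclusion Z ∧ Untouched G₁ Z
  have hI₁ : I G₁ := ⟨.of_quiescent h₁, fun c => .inr ⟨rfl, rfl⟩⟩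
  have hI : ∀ E G α E' G', I G → Step P (E, G) α (E', G') → ¬ α.IsCommit → I G' :=
    fun _ _ _ _ _ hG hs hα => ⟨hG.1.step hs, hG.2.step hs hα⟩
  have hIG : I G := by
    suffices H : ∀ X Y T, Exec P X T Y → (∀ α ∈ T, ¬ α.IsCommit) → I X.2 → I Y.2 from
      H _ _ _ h hT hI₁
    intro X Y T h
    induction h with
    | nil => exact fun _ => id
    | cons hs _ ih =>
      intro hT hX
      obtain ⟨hα, hT⟩ := List.forall_mem_cons.1 hT
      exact ih hT (hI _ _ _ _ _ hX hs hα)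
  -- locks persist up to the final state, where `e` excludes all the other events from `W`, so these
  -- have never been activated there
  have hother : ∀ (Z : Config L) T', Exec P Z T' (E, G) → (∀ α ∈ T', ¬ α.IsCommit) →
      ∀ c ∈ W, ∀ a ∈ (Z.2 c).A, a.eid = e := by
    rintro Z T' hr hT' c ⟨b, hb, rfl, hbex⟩ a ha
    obtain ⟨a', ha', hae, -⟩ := hr.persists hT' ha
    exact hae.symm.trans (hIG.1 c b hb a' ha' hbex)
  have hself : ∀ (Z : Config L) T', Exec P Z T' (E, G) → (∀ α ∈ T', ¬ α.IsCommit) →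
      ∀ c, c ∉ W → ∀ a ∈ (Z.2 c).A, a.eid = e → a.mode = .ro := by
    intro Z T' hr hT' c hc a ha hae
    cases hm : a.mode with
    | ro => rfl
    | ex =>
      obtain ⟨a', ha', hae', hm'⟩ := hr.persists hT' ha
      exact absurd ⟨a', ha', hae'.trans hae, hm'.trans hm⟩ hc
  have hsep₁ : ∀ (Z : Config L) T', I Z.2 → Exec P Z T' (E, G) → (∀ α ∈ T', ¬ α.IsCommit) →
      Separated (· = e) W G₁ Z.2 := by
    intro Z T' hZ hr hT'
    refine ⟨fun c hc a ha hae => ⟨hself Z T' hr hT' c hc a ha hae, ?_⟩,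
      fun c hc a ha hae => absurd (hother Z T' hr hT' c hc a ha) hae⟩
    -- an exclusive lock on `c` could only be held by `e`, contrary to the choice of `W`, so nobody
    -- has modified `c` yet
    rcases hZ.2 c with ⟨b, hb, hbex⟩ | h
    · have hbe : b.eid = e := (hZ.1 c b hb a ha hbex).symm.trans hae
      rw [hself Z T' hr hT' c hc b hb hbe] at hbex
      exact nomatch hbex
    · exact h
  have hsep₂ : ∀ (Z : Config L) T', I Z.2 → Exec P Z T' (E, G) → (∀ α ∈ T', ¬ α.IsCommit) →
      Separated (· ≠ e) Wᶜ G' Z.2 := by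
    intro Z T' _ hr hT'
    exact ⟨fun c hc a ha hae => absurd (hother Z T' hr hT' c (not_not.1 hc) a ha) hae,
      fun c hc a ha hae => hself Z T' hr hT' c hc a ha (not_not.1 hae)⟩
  obtain ⟨hE', -, hA', hq'⟩ := hs.commit_inv
  have hA : ∀ c, ∀ a ∈ (G' c).A, a.eid ≠ e := fun c a ha hae => hA' ⟨c, a, ha, hae⟩
  have hstart : Aeon.restrict (· = e) W G₁ G₁ = G₁ := by
    funext c
    obtain ⟨hq, hA⟩ := h₁ c
    exact Ctx.ext (by simp [Aeon.restrict, Ctx.restrict, reqs, hq]) (ite_self _) (ite_self _)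
      (by simp [Aeon.restrict, Ctx.restrict, hA])
  -- the run of `e` ends where the run of the other events starts
  have hmid : Aeon.restrict (· = e) W G₁ G' = Aeon.restrict (· ≠ e) Wᶜ G' G₁ := by
    funext c
    obtain ⟨hq, hA₁⟩ := h₁ c
    have hr : reqs (· = e) (G' c).q = [] := by simpa [reqs] using hq' c
    refine Ctx.ext ?_ ?_ ?_ ?_
    · simp only [Aeon.restrict, Ctx.restrict, hq, hr]
      simp [reqs]
    · by_cases hc : c ∈ W <;> simp [Aeon.restrict, Ctx.restrict, hc]
    · by_cases hc : c ∈ W <;> simp [Aeon.restrict, Ctx.restrict, hc]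
    · ext a
      simpa [Aeon.restrict, Ctx.restrict, hA₁] using hA c a
  have hend : Aeon.restrict (· ≠ e) Wᶜ G' G' = G' := by
    funext c
    refine Ctx.ext ?_ (ite_self _) (ite_self _) ?_
    · simpa [Aeon.restrict, Ctx.restrict, reqs] using hq' c
    · ext a
      simpa [Aeon.restrict, Ctx.restrict] using hA c a
  have hE₀ (q : L.EID → Prop) : {x ∈ (∅ : Set L.EID) | q x} = ∅ := by
    ext x
    exact ⟨fun hx => hx.1, False.elim⟩
  have hE₁ : {x ∈ E' | x = e} = ∅ := by
    rw [hE']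
    ext x
    exact ⟨fun hx => hx.1.2 hx.2, False.elim⟩
  have hE₂ : {x ∈ E' | x ≠ e} = E' := by
    rw [hE']
    ext x
    exact ⟨fun hx => hx.1, fun hx => ⟨hx, hx.2⟩⟩
  have hrun₁ := (Exec.restrict h hT hI₁ hI hsep₁).snoc
    (hs.restrict (hsep₁ _ [] hIG .nil (by simp)) rfl)
  have hrun₂ := Exec.restrict h hT hI₁ hI hsep₂
  have hne : ¬ (Action.commit e v : Action L).eid ≠ e := fun h => h rfl
  have hsep := hsep₂ _ [] hIG .nil (by simp)
  simp only [← hs.restrict_eq hsep hne, ← hs.setOf_mem_and_eq (p := (· ≠ e)) hne, hend, hE₂,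
    hE₀, ← hmid] at hrun₂
  simp only [hstart, hE₁, hE₀] at hrun₁
  refine ⟨_, fun c => ?_, Exec.linExec (e := e) hrun₁ ?_ ?_, hrun₂⟩
  · constructor
    · simpa [Aeon.restrict, Ctx.restrict, reqs] using hq' c
    · ext a
      simpa [Aeon.restrict, Ctx.restrict] using hA c a
  · intro α hα
    rcases List.mem_append.1 hα with hα | hα
    · simpa [acts] using (List.mem_filter.1 hα).2
    · obtain rfl := List.mem_singleton.1 hα
      rfl
  · rintro _ ⟨c, a, ha, -⟩
    simp [(h₁ c).2] at ha

/-! ### Histories -/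

theorem acts_append (p : L.EID → Prop) (T T' : List (Action L)) :
    acts p (T ++ T') = acts p T ++ acts p T' := by
  simp [acts]

theorem history_append (T T' : List (Action L)) :
    history (T ++ T') = history T ++ history T' := by
  simp [history]

theorem Action.not_isCall_internal (e : L.EID) : ¬ (Action.internal e : Action L).IsCall := by
  rintro ⟨_, _, _, _, h⟩
  cases h

theorem Action.not_isCommit_internal (e : L.EID) : ¬ (Action.internal e : Action L).IsCommit := by
  rintro ⟨_, _, h⟩
  cases h

theorem Action.not_isCommit_call (e : L.EID) (c : L.CID) (m : L.Meth) (vs : List (Val L)) :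
    ¬ (Action.call e c m vs).IsCommit := by
  rintro ⟨_, _, h⟩
  cases h

theorem Action.not_isCall_commit (e : L.EID) (v : Val L) :
    ¬ (Action.commit e v : Action L).IsCall := by
  rintro ⟨_, _, _, _, h⟩
  cases h

theorem history_snoc_internal (T : List (Action L)) (e : L.EID) :
    history (T ++ [.internal e]) = history T := by
  simp [history, Action.not_isCall_internal, Action.not_isCommit_internal]

theorem history_snoc_call (T : List (Action L)) (e : L.EID) (c : L.CID) (m : L.Meth)
    (vs : List (Val L)) : history (T ++ [.call e c m vs]) = history T ++ [.call e c m vs] := by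
  have : (Action.call e c m vs).IsCall := ⟨_, _, _, _, rfl⟩
  simp [history, this]

theorem history_snoc_commit (T : List (Action L)) (e : L.EID) (v : Val L) :
    history (T ++ [.commit e v]) = history T ++ [.commit e v] := by
  have : (Action.commit e v : Action L).IsCommit := ⟨_, _, rfl⟩
  simp [history, this]

theorem history_acts (p : L.EID → Prop) (T : List (Action L)) :
    history (acts p T) = acts p (history T) := by
  simp only [history, acts, List.filter_filter, Bool.and_comm]

theorem isCall_of_mem_pendingCalls {H : List (Action L)} {α : Action L}
    (h : α ∈ pendingCalls H) : α.IsCall := by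
  induction H with
  | nil => simp [pendingCalls] at h
  | cons β H ih =>
    rw [pendingCalls] at h
    split_ifs at h with hβ
    · rcases List.mem_cons.1 h with rfl | h
      exacts [hβ.1, ih h]
    · exact ih h

theorem pendingCalls_cons_pos {H : List (Action L)} {α : Action L} (hα : α.IsCall)
    (h : ∀ β ∈ H, β.IsCommit → β.eid ≠ α.eid) : pendingCalls (α :: H) = α :: pendingCalls H :=
  if_pos ⟨hα, h⟩

theorem pendingCalls_cons_neg {H : List (Action L)} {α : Action L}
    (h : ¬ (α.IsCall ∧ ∀ β ∈ H, β.IsCommit → β.eid ≠ α.eid)) :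
    pendingCalls (α :: H) = pendingCalls H :=
  if_neg h

theorem pendingCalls_snoc_call (H : List (Action L)) (e : L.EID) (c : L.CID) (m : L.Meth)
    (vs : List (Val L)) :
    pendingCalls (H ++ [.call e c m vs]) = pendingCalls H ++ [.call e c m vs] := by
  induction H with
  | nil =>
    have : (Action.call e c m vs).IsCall := ⟨_, _, _, _, rfl⟩
    simp [pendingCalls, this]
  | cons β H ih =>
    have : (∀ γ ∈ H ++ [.call e c m vs], γ.IsCommit → γ.eid ≠ β.eid) ↔
        ∀ γ ∈ H, γ.IsCommit → γ.eid ≠ β.eid := by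
      simp [or_imp, forall_and, Action.not_isCommit_call]
    by_cases hβ : β.IsCall ∧ ∀ γ ∈ H, γ.IsCommit → γ.eid ≠ β.eid
    · rw [List.cons_append, pendingCalls_cons_pos hβ.1 (this.2 hβ.2), ih,
        pendingCalls_cons_pos hβ.1 hβ.2]
      rfl
    · rw [List.cons_append, pendingCalls_cons_neg fun h => hβ ⟨h.1, this.1 h.2⟩, ih,
        pendingCalls_cons_neg hβ]

theorem pendingCalls_snoc_commit (H : List (Action L)) (e : L.EID) (v : Val L) :
    pendingCalls (H ++ [.commit e v]) = acts (· ≠ e) (pendingCalls H) := by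
  induction H with
  | nil => simp [pendingCalls, acts, Action.not_isCall_commit]
  | cons β H ih =>
    have : (∀ γ ∈ H ++ [.commit e v], γ.IsCommit → γ.eid ≠ β.eid) ↔
        (∀ γ ∈ H, γ.IsCommit → γ.eid ≠ β.eid) ∧ e ≠ β.eid := by
      have : (Action.commit e v : Action L).IsCommit := ⟨_, _, rfl⟩
      simp [or_imp, forall_and, this, Action.eid]
    rw [List.cons_append]
    by_cases hβ : β.IsCall ∧ ∀ γ ∈ H, γ.IsCommit → γ.eid ≠ β.eid
    · rw [pendingCalls_cons_pos hβ.1 hβ.2]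
      by_cases he : e = β.eid
      · rw [pendingCalls_cons_neg fun h => (this.1 h.2).2 he, ih]
        simp [acts, he]
      · rw [pendingCalls_cons_pos hβ.1 (this.2 ⟨hβ.2, he⟩), ih]
        simp [acts, Ne.symm he]
    · rw [pendingCalls_cons_neg fun h => hβ ⟨h.1, (this.1 h.2).1⟩, ih, pendingCalls_cons_neg hβ]

theorem sequential_snoc (ops : List (Completed L)) (o : Completed L) :
    sequential (ops ++ [o]) =
      sequential ops ++ [.call o.e o.c o.m o.vs, .commit o.e o.v] := by
  simp [sequential]

theorem LinearizedAtCommit.snoc_call {H : List (Action L)} {ops : List (Completed L)}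
    (h : LinearizedAtCommit H ops) (e : L.EID) (c : L.CID) (m : L.Meth) (vs : List (Val L)) :
    LinearizedAtCommit (H ++ [.call e c m vs]) ops := by
  obtain ⟨h₁, h₂, h₃, h₄⟩ := h
  refine ⟨fun o ho => ?_, fun j α hj hα => ?_, h₃, h₄⟩
  · obtain ⟨hb, hc, hr⟩ := h₁ o ho
    exact ⟨hb.append _, getElem?_snoc_eq_some.2 (.inl hc), getElem?_snoc_eq_some.2 (.inl hr)⟩
  · rcases getElem?_snoc_eq_some.1 hj with hj | ⟨-, rfl⟩
    · exact h₂ j α hj hα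
    · exact absurd hα (Action.not_isCommit_call _ _ _ _)

theorem LinearizedAtCommit.snoc_commit {H : List (Action L)} {ops : List (Completed L)}
    (h : LinearizedAtCommit H ops) {i : ℕ} {e : L.EID} {c : L.CID} {m : L.Meth}
    {vs : List (Val L)} (hi : PendingAt H i e c m vs) (v : Val L) :
    LinearizedAtCommit (H ++ [.commit e v]) (ops ++ [⟨i, H.length, e, c, m, vs, v⟩]) := by
  obtain ⟨h₁, h₂, h₃, h₄⟩ := h
  have hlt : ∀ o ∈ ops, o.res < H.length := fun o ho => lt_length_of_getElem? (h₁ o ho).2.2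
  refine ⟨fun o ho => ?_, fun j α hj hα => ?_, ?_, ?_⟩
  · rcases List.mem_append.1 ho with ho | ho
    · obtain ⟨hb, hc, hr⟩ := h₁ o ho
      exact ⟨hb.append _, getElem?_snoc_eq_some.2 (.inl hc), getElem?_snoc_eq_some.2 (.inl hr)⟩
    · obtain rfl := List.mem_singleton.1 ho
      exact ⟨PendingAt.belongs (α := .commit e v) hi (Action.not_isCall_commit e v),
        getElem?_snoc_eq_some.2 (.inl hi.1), getElem?_snoc_eq_some.2 (.inr ⟨rfl, rfl⟩)⟩
  · rcases getElem?_snoc_eq_some.1 hj with hj | ⟨rfl, rfl⟩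
    · obtain ⟨o, ho, hoj⟩ := h₂ j α hj hα
      exact ⟨o, List.mem_append_left _ ho, hoj⟩
    · exact ⟨_, List.mem_append_right _ List.mem_cons_self, rfl⟩
  · refine List.pairwise_append.2 ⟨h₃, List.pairwise_singleton _ _, fun o ho o' ho' => ?_⟩
    obtain rfl := List.mem_singleton.1 ho'
    exact hlt o ho
  · refine List.pairwise_append.2 ⟨h₄, List.pairwise_singleton _ _, fun o ho o' ho' => ?_⟩
    obtain rfl := List.mem_singleton.1 ho'
    have := (h₁ o ho).1.1
    have := hlt o ho
    simp only
    omega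

/-- Every running event has exactly one pending call in the history. -/
theorem Exec.exists_unique_pendingAt {G₀ : Network L} {T : List (Action L)} {X : Config L}
    (h : Exec P (∅, G₀) T X) :
    (∀ α ∈ pendingCalls (history T), α.eid ∈ X.1) ∧
    ∀ e ∈ X.1, ∃ i c m vs, PendingAt (history T) i e c m vs ∧
      acts (· = e) (pendingCalls (history T)) = [.call e c m vs] := by
  induction h using Run.snoc_induction with
  | nil => exact ⟨by simp [history, pendingCalls], fun e he => absurd he (Set.notMem_empty e)⟩
  | snoc T Y α Z _ hs ih =>
    cases α with
    | internal e => rwa [history_snoc_internal, hs.internal_inv.1]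
    | call e c m vs =>
      obtain ⟨he, hE⟩ := hs.call_inv
      rw [history_snoc_call, pendingCalls_snoc_call, hE]
      refine ⟨fun α hα => ?_, fun e' he' => ?_⟩
      · rcases List.mem_append.1 hα with hα | hα
        · exact .inr (ih.1 α hα)
        · obtain rfl := List.mem_singleton.1 hα
          exact .inl rfl
      · by_cases hee : e' = e
        · subst hee
          refine ⟨_, c, m, vs, .self _ _ _ _ _, ?_⟩
          have : acts (· = e') (pendingCalls (history T)) = [] := by
            simp only [acts, List.filter_eq_nil_iff, decide_eq_true_eq]
            rintro α hα rfl
            exact he (ih.1 α hα)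
          rw [acts_append, this]
          simp [acts, Action.eid]
        · obtain ⟨i, c', m', vs', hi, ha⟩ := ih.2 e' (he'.resolve_left hee)
          refine ⟨i, c', m', vs', hi.snoc fun h => absurd h.symm hee, ?_⟩
          rw [acts_append, ha]
          simp [acts, Action.eid, Ne.symm hee]
    | commit e v =>
      rw [history_snoc_commit, pendingCalls_snoc_commit, hs.commit_inv.1]
      refine ⟨fun α hα => ?_, fun e' he' => ?_⟩
      · simp only [acts, List.mem_filter, decide_eq_true_eq] at hα
        exact ⟨ih.1 α hα.1, hα.2⟩
      · obtain ⟨i, c', m', vs', hi, ha⟩ := ih.2 e' he'.1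
        refine ⟨i, c', m', vs', hi.snoc fun h => absurd h.symm he'.2, ?_⟩
        rw [← ha]
        simp only [acts, List.filter_filter]
        refine List.filter_congr fun α _ => ?_
        by_cases h : α.eid = e'
        · have : e' ≠ e := he'.2
          simp [h, this]
        · simp [h]

/-- Induction along the execution, which is kept split into a sequential part made of the committed
events and a part without commits made of the others. A new commit moves its event from the second
part to the end of the first one. -/
theorem Exec.linearizable {G₀ : Network L} (h₀ : Quiescent G₀) {T : List (Action L)}
    {X : Config L} (h : Exec P (∅, G₀) T X) :
    ∃ ops : List (Completed L), LinearizedAtCommit (history T) ops ∧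
      ∃ (T₁ T₂ : List (Action L)) (G₁ : Network L),
        LinExec P (∅, G₀) T₁ (∅, G₁) ∧ history T₁ = sequential ops ∧ Quiescent G₁ ∧
        Exec P (∅, G₁) T₂ X ∧ history T₂ = pendingCalls (history T) := by
  induction h using Run.snoc_induction with
  | nil =>
    refine ⟨[], ⟨by simp, by simp [history], .nil, .nil⟩, [], [], G₀, .nil, ?_, h₀, .nil, ?_⟩ <;>
      simp [history, sequential, pendingCalls]
  | snoc T Y α Z hr hs ih =>
    obtain ⟨ops, hops, T₁, T₂, G₁, hT₁, hH₁, hG₁, hT₂, hH₂⟩ := ih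
    cases α with
    | internal e =>
      rw [history_snoc_internal]
      exact ⟨ops, hops, T₁, T₂ ++ [.internal e], G₁, hT₁, hH₁, hG₁, hT₂.snoc hs,
        by rw [history_snoc_internal, hH₂]⟩
    | call e c m vs =>
      rw [history_snoc_call]
      exact ⟨ops, hops.snoc_call e c m vs, T₁, T₂ ++ [.call e c m vs], G₁, hT₁, hH₁, hG₁,
        hT₂.snoc hs, by rw [history_snoc_call, hH₂, pendingCalls_snoc_call]⟩
    | commit e v =>
      have hE : e ∈ Y.1 := (Exec.tracked h₀ hr).1 e hs.commit_inv.2.1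
      obtain ⟨i, c, m, vs, hi, hacts⟩ := (Exec.exists_unique_pendingAt hr).2 e hE
      have hnc : ∀ α ∈ T₂, ¬ α.IsCommit := by
        intro α hα hc
        have : α ∈ pendingCalls (history T) := by
          rw [← hH₂]
          simp [history, hα, hc]
        obtain ⟨_, _, _, _, rfl⟩ := isCall_of_mem_pendingCalls this
        exact Action.not_isCommit_call _ _ _ _ hc
      obtain ⟨G₂, hG₂, hlin, hrest⟩ := Exec.extract hG₁ hT₂ hnc hs
      rw [history_snoc_commit]
      refine ⟨_, hops.snoc_commit hi v, _, _, G₂, hT₁.append hlin, ?_, hG₂, hrest, ?_⟩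
      · rw [history_append, hH₁, history_snoc_commit, history_acts, hH₂, hacts, sequential_snoc]
        rfl
      · rw [history_acts, hH₂, pendingCalls_snoc_commit]

end Aeon

theorem mainTheorem3 {L : AeonLang.{u}} (P : Program L) (G₀ : Network L) (h₀ : Quiescent G₀) :
    (∀ (T : List (Action L)) (X : Config L), LinExec P (∅, G₀) T X → Isolated T ∧ KeepsOrder T) ∧
    (∀ (T : List (Action L)) (E : Set L.EID) (G : Network L), Exec P (∅, G₀) T (E, G) →
      ∃ ops : List (Completed L), LinearizedAtCommit (history T) ops ∧
        ∃ (T₁ T₂ : List (Action L)) (G₁ : Network L),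
          LinExec P (∅, G₀) T₁ (∅, G₁) ∧ history T₁ = sequential ops ∧ Quiescent G₁ ∧
          Exec P (∅, G₁) T₂ (E, G) ∧ history T₂ = pendingCalls (history T)) :=
  ⟨fun _ _ h => ⟨h.isolated, Exec.keepsOrder h₀ h.exec⟩,
    fun _ _ _ h => Exec.linearizable h₀ h⟩
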